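/- Let $\theta\in(0,\pi/4]$, let $\phi\in\big(\max\{-2\theta,-\pi+2\theta\},\min\{2\theta,\pi-2\theta\}\big)\setminus\{0\}$, and let $\tau\in\mathbb R$ satisfy $$\frac1{\tau^2}=\frac{\sin^2(2\theta)}{\tan^2(\phi)}-\cos^2(2\theta).$$ Consider the extended tilted-CHSH expression $$S_{\theta,\phi}=A_0\otimes\frac{B_0+B_1}{\cos\phi}+\tau^2\Big[\sin(2\theta)\,A_1\otimes\frac{B_0-B_1}{\sin\phi}+\cos(2\theta)\,\mathbb 1\otimes\frac{B_0+B_1}{\cos\phi}\Big],$$ where $A_x=\sum_a(-1)^aM_{a|x}$, $B_y=\sum_b(-1)^bN_{b|y}$ and $a,b,x,y\in\{0,1\}$. *Compiled scenario.* Fix a set of unitary gates on at most two qubits that is closed under inverses and contains the Hadamard and controlled-NOT gates. Quantum polynomial time (QPT) means: implemented by a logspace-uniform family of polynomial-size circuits over this gate set. Let $\mathsf{Gen},\mathsf{Enc},\mathsf{Dec}$ be the key generation, encryption and decryption algorithms of a (quantum homomorphic) encryption scheme such that for every QPT adversary with access to the oracle $\mathsf{Enc}(\cdot,\mathsf{sk})$,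 the probabilities of outputting $1$ on an encryption of $x_0$ and on an encryption of $x_1$ ($x_0,x_1\in\{0,1\}$), under a fresh key $\mathsf{sk}\leftarrow\mathsf{Gen}(1^\lambda)$, differ by at most a negligible function of $\lambda$. No other property of the scheme is needed. A QPT compiled model consists, for every $\lambda$, of the subnormalized post-measurement states $|\Psi^{(\lambda)}_{\alpha|\chi}\rangle$ obtained by running a QPT circuit on the encrypted question $\chi$ (and zeros) and measuring an encrypted answer $\alpha$, and of POVMs $\{N^{(\lambda)}_{b|y}\}_b$, $y\in\{0,1\}$, each implemented by a QPT circuit (possibly with ancillas). Its behaviour is $$p^{(\lambda)}(a,b|x,y)=\mathop{\mathbb E}_{\mathsf{sk}\leftarrow\mathsf{Gen}(1^\lambda)}\ \mathop{\mathbb E}_{\chi\leftarrow\mathsf{Enc}(x,\mathsf{sk})}\ \sum_{\alpha}\Pr[\mathsf{Dec}(\alpha,\mathsf{sk})=a]\,\langle\Psi^{(\lambda)}_{\alpha|\chi}|N^{(\lambda)}_{b|y}|\Psi^{(\lambda)}_{\alpha|\chi}\rangle .$$ Its value $I^{(\lambda)}_{\theta,\phi}$ on $S_{\theta,\phi}$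 is obtained by replacing $A_x\otimes B_y$ by $\sum_{a,b}(-1)^{a+b}p^{(\lambda)}(a,b|x,y)$ and $\mathbb 1\otimes B_y$ by $\sum_xq(x)\sum_{a,b}(-1)^bp^{(\lambda)}(a,b|x,y)$, where $q$ is an arbitrary fixed distribution on $\{0,1\}$. **Theorem.** For every QPT compiled model there is a negligible function $\mathrm{negl}$ (for every $k\in\mathbb N$, $\mathrm{negl}(\lambda)\le\lambda^{-k}$ for all large $\lambda$) such that for all $\lambda$ $$I^{(\lambda)}_{\theta,\phi}\le\eta^{\mathrm Q}_{\theta,\phi}+\mathrm{negl}(\lambda),\qquad \eta^{\mathrm Q}_{\theta,\phi}=2(1+\tau^2).$$ -/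

import Mathlib

open scoped Kronecker

noncomputable section

/-- Negligible functions of the security parameter. -/
def Negligible (f : ℕ → ℝ) : Prop :=
  ∀ k : ℕ, ∃ N : ℕ, ∀ n ≥ N, f n ≤ 1 / (n : ℝ) ^ k

/-! ### Logspace-uniform families of circuits

Programs work on registers that hold natural numbers and write to an output list, one symbol
at a time. A program mentions finitely many registers, so on input `1 ^ lam` it runs in space
`O(log lam)` exactly when the contents of its registers stay polynomially bounded in `lam`,
that is, when each register has `O(log lam)` bits. The output is write-only and is not counted. -/

/-- Register programs writing symbols of type `τ`. Registers are named by natural numbers. -/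
inductive Prog (τ : Type) : Type
  /-- do nothing -/
  | skip : Prog τ
  /-- `r_i := 0` -/
  | zero (i : ℕ) : Prog τ
  /-- `r_i := r_j` -/
  | copy (i j : ℕ) : Prog τ
  /-- `r_i := r_i + 1` -/
  | inc (i : ℕ) : Prog τ
  /-- `r_i := r_i - 1` (stays at `0`) -/
  | dec (i : ℕ) : Prog τ
  /-- write the instruction "`t` on wires `r_i`, `r_j`" -/
  | emit (t : τ) (i j : ℕ) : Prog τ
  /-- `p` followed by `q` -/
  | seq (p q : Prog τ) : Prog τ
  /-- if `r_i = r_j` then `p` else `q` -/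
  | ifEq (i j : ℕ) (p q : Prog τ) : Prog τ
  /-- while `r_i ≠ r_j` do `p` -/
  | whileNe (i j : ℕ) (p : Prog τ) : Prog τ

/-- `Exec B p s out s'`: started with register contents `s`, the program `p` halts with register
contents `s'` after writing `out`, and no increment ever produces a value above `B`. -/
inductive Exec {τ : Type} (B : ℕ) :
    Prog τ → (ℕ → ℕ) → List (τ × ℕ × ℕ) → (ℕ → ℕ) → Prop
  | skip (s : ℕ → ℕ) : Exec B Prog.skip s [] s
  | zero (s : ℕ → ℕ) (i : ℕ) : Exec B (Prog.zero i) s [] (Function.update s i 0)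
  | copy (s : ℕ → ℕ) (i j : ℕ) : Exec B (Prog.copy i j) s [] (Function.update s i (s j))
  | inc (s : ℕ → ℕ) (i : ℕ) (h : s i + 1 ≤ B) :
      Exec B (Prog.inc i) s [] (Function.update s i (s i + 1))
  | dec (s : ℕ → ℕ) (i : ℕ) : Exec B (Prog.dec i) s [] (Function.update s i (s i - 1))
  | emit (s : ℕ → ℕ) (t : τ) (i j : ℕ) : Exec B (Prog.emit t i j) s [(t, s i, s j)] s
  | seq {p q : Prog τ} {s s' s'' : ℕ → ℕ} {o o' : List (τ × ℕ × ℕ)}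
      (hp : Exec B p s o s') (hq : Exec B q s' o' s'') : Exec B (Prog.seq p q) s (o ++ o') s''
  | ifTrue {i j : ℕ} {p q : Prog τ} {s s' : ℕ → ℕ} {o : List (τ × ℕ × ℕ)}
      (h : s i = s j) (hp : Exec B p s o s') : Exec B (Prog.ifEq i j p q) s o s'
  | ifFalse {i j : ℕ} {p q : Prog τ} {s s' : ℕ → ℕ} {o : List (τ × ℕ × ℕ)}
      (h : s i ≠ s j) (hq : Exec B q s o s') : Exec B (Prog.ifEq i j p q) s o s'
  | whileStop {i j : ℕ} {p : Prog τ} {s : ℕ → ℕ}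
      (h : s i = s j) : Exec B (Prog.whileNe i j p) s [] s
  | whileStep {i j : ℕ} {p : Prog τ} {s s' s'' : ℕ → ℕ} {o o' : List (τ × ℕ × ℕ)}
      (h : s i ≠ s j) (hp : Exec B p s o s') (hw : Exec B (Prog.whileNe i j p) s' o' s'') :
      Exec B (Prog.whileNe i j p) s (o ++ o') s''

/-- `C lam` is a polynomial-size circuit description on `n lam` wires of which the first `r lam` are
the output wires, and one program, started with `lam` in register `0` and zeros elsewhere, writes
`C lam` and halts with the number `n lam` of wires in register `0` and the number `r lam` of output
wires in register `1`, using `O(log lam)` bits. -/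
def LogspaceUniform {τ : Type} (n r : ℕ → ℕ) (C : ℕ → List (τ × ℕ × ℕ)) : Prop :=
  (∀ lam, ∀ op ∈ C lam, op.2.1 < n lam ∧ op.2.2 < n lam ∧ op.2.1 ≠ op.2.2) ∧
  ∃ (p : Prog τ) (c : ℕ), ∀ lam : ℕ,
    (C lam).length ≤ (lam + 2) ^ c ∧
    ∃ s' : ℕ → ℕ,
      Exec ((lam + 2) ^ c) p (fun i => if i = 0 then lam else 0) (C lam) s' ∧
      s' 0 = n lam ∧ s' 1 = r lam

/-! ### Quantum circuits -/

/-- The state space of `n` qubits, with its computational basis. -/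
abbrev Qubits (n : ℕ) : Type := EuclideanSpace ℂ (Fin n → Bool)

/-- Two-qubit operators, as matrices in the computational basis (row = output, column = input). -/
abbrev GateMatrix : Type := Matrix (Bool × Bool) (Bool × Bool) ℂ

/-- The one-qubit Hadamard matrix. -/
def hadamard : Matrix Bool Bool ℂ :=
  Matrix.of fun a b => (if a && b then -1 else 1) / (Real.sqrt 2 : ℂ)

/-- The controlled-NOT; the first qubit is the control. -/
def cnot : GateMatrix :=
  Matrix.of fun p q => if p = (q.1, xor q.1 q.2) then 1 else 0

/-- Gate sets: unitary gates on (at most) two qubits, closed under inverses, among them the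
Hadamard gate and the controlled-NOT. A one-qubit gate `u` is given as `u ⊗ 1`. -/
structure IsGateSet (G : Set GateMatrix) : Prop where
  unitary : ∀ g ∈ G, g ∈ Matrix.unitaryGroup (Bool × Bool) ℂ
  inv_mem : ∀ g ∈ G, Matrix.conjTranspose g ∈ G
  hadamard_mem : hadamard ⊗ₖ (1 : Matrix Bool Bool ℂ) ∈ G
  cnot_mem : cnot ∈ G

/-- The gate `g` applied to the ordered pair `(a, b)` of distinct wires (identity otherwise). -/
def applyGate {n : ℕ} (g : GateMatrix) (a b : ℕ) (ψ : Qubits n) : Qubits n :=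
  if h : a < n ∧ b < n ∧ a ≠ b then
    WithLp.toLp 2 fun s => ∑ p : Bool × Bool, g (s ⟨a, h.1⟩, s ⟨b, h.2.1⟩) p *
      ψ (Function.update (Function.update s ⟨a, h.1⟩ p.1) ⟨b, h.2.1⟩ p.2)
  else ψ

/-- The gates of a circuit, applied from left to right. -/
def runCircuit {n : ℕ} {G : Set GateMatrix} : List (G × ℕ × ℕ) → Qubits n → Qubits n
  | [], ψ => ψ
  | (g, a, b) :: C, ψ => runCircuit C (applyGate (g : GateMatrix) a b ψ)

/-- The bit on wire `i` of a basis state (`false` if there is no such wire). -/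
def readWire {n : ℕ} (s : Fin n → Bool) (i : ℕ) : Bool :=
  if h : i < n then s ⟨i, h⟩ else false

/-- Orthogonal projection onto the span of the basis states with property `S`. -/
def proj {n : ℕ} (S : (Fin n → Bool) → Prop) [DecidablePred S] (ψ : Qubits n) : Qubits n :=
  WithLp.toLp 2 fun s => if S s then ψ s else 0

/-- The basis state with the bits of `c` on the first `k` wires and zeros on all other wires. -/
def inputKet (n : ℕ) {k : ℕ} (c : Fin k → Bool) : Qubits n :=
  EuclideanSpace.single (fun i => if h : (i : ℕ) < k then c ⟨i, h⟩ else false) 1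

/-- `ψ ⊗ |0…0⟩` with `m` additional wires. -/
def padZeros {n : ℕ} (m : ℕ) (ψ : Qubits n) : Qubits (n + m) :=
  WithLp.toLp 2 fun s =>
    if ∀ i : Fin m, s (Fin.natAdd n i) = false then ψ (fun i => s (Fin.castAdd m i)) else 0

/-- The bits of `c` added modulo two to the wires `a, a + 1, …, a + k - 1`. -/
def xorWires {n k : ℕ} (c : Fin k → Bool) (a : ℕ) (ψ : Qubits n) : Qubits n :=
  WithLp.toLp 2 fun s => ψ fun i =>
    xor (s i) (if h : a ≤ (i : ℕ) ∧ (i : ℕ) - a < k then c ⟨(i : ℕ) - a, h.2⟩ else false)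

/-! ### Encryption and security -/

/-- The algorithms of a homomorphic encryption scheme that enter the compiled scenario: key
generation, encryption of the questions `0 = false` and `1 = true`, and decryption of the first
answer to a bit. For security parameter `lam`, keys are `keyLen lam` bits long, encrypted
questions `ctLen lam` bits, encrypted answers `ansLen lam` bits. The efficiency of these algorithms,
homomorphic evaluation and its correctness are not demanded: the result below needs security only. -/
structure EncryptionScheme where
  keyLen : ℕ → ℕ
  ctLen : ℕ → ℕ
  ansLen : ℕ → ℕ
  Gen : (lam : ℕ) → PMF (Fin (keyLen lam) → Bool)
  Enc : (lam : ℕ) → (Fin (keyLen lam) → Bool) → Bool → PMF (Fin (ctLen lam) → Bool)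
  Dec : (lam : ℕ) → (Fin (keyLen lam) → Bool) → (Fin (ansLen lam) → Bool) → PMF Bool

/-- Probability that a circuit with access to the randomized classical oracle `enc` outputs `1` on
wire `0` when started in (the subnormalized) state `ψ`. An instruction `(some g, a, b)` is a gate.
An instruction `(none, a, b)` is an oracle call: the plaintext is measured on wire `a`, and a fresh
encryption of it is added modulo two to the wires from `b` on. -/
def acceptProb {n k : ℕ} {G : Set GateMatrix} (enc : Bool → PMF (Fin k → Bool)) :
    List (Option G × ℕ × ℕ) → Qubits n → ℝ
  | [], ψ => ‖proj (fun s => readWire s 0 = true) ψ‖ ^ 2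
  | (some g, a, b) :: C, ψ => acceptProb enc C (applyGate (g : GateMatrix) a b ψ)
  | (none, a, b) :: C, ψ =>
      ∑ x : Bool, ∑ c : Fin k → Bool, (enc x c).toReal *
        acceptProb enc C (xorWires c b (proj (fun s => readWire s a = x) ψ))

namespace EncryptionScheme

/-- Probability that the adversary `C` (a circuit on `n` wires) outputs `1` when given an encryption
of `x` and access to the encryption oracle, under a freshly generated key. -/
def adversaryProb (E : EncryptionScheme) {G : Set GateMatrix} (lam n : ℕ)
    (C : List (Option G × ℕ × ℕ)) (x : Bool) : ℝ :=
  ∑ sk, (E.Gen lam sk).toReal * ∑ χ, (E.Enc lam sk x χ).toReal *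
    acceptProb (E.Enc lam sk) C (inputKet n χ)

/-- Security against quantum polynomial-time distinguishers (over the gate set `G`). -/
def IsSecure (E : EncryptionScheme) (G : Set GateMatrix) : Prop :=
  ∀ (n : ℕ → ℕ) (C : ℕ → List (Option G × ℕ × ℕ)), LogspaceUniform n (fun _ => 1) C →
    ∀ x₀ x₁ : Bool, Negligible fun lam =>
      |E.adversaryProb lam (n lam) (C lam) x₀ - E.adversaryProb lam (n lam) (C lam) x₁|

end EncryptionScheme

/-! ### Compiled models -/

/-- A compiled quantum model at a fixed security parameter, for encrypted questions of `k` bits and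
encrypted answers of `l` bits: the subnormalized states `|Ψ_{α|χ}⟩` after the first round and
the measurements `{N_{b|y}}_b` of the second round. -/
structure CompiledModel (k l : ℕ) where
  n : ℕ
  /-- `state χ α` is `|Ψ_{α|χ}⟩` -/
  state : (Fin k → Bool) → (Fin l → Bool) → Qubits n
  /-- `N y b` is `N_{b|y}` -/
  N : Bool → Bool → (Qubits n →L[ℂ] Qubits n)
  N_pos : ∀ y b, (N y b).IsPositive
  N_sum : ∀ y, ∑ b, N y b = 1

/-- The states and measurements of a family of compiled models are obtained by quantum
polynomial-time procedures: a logspace-uniform family of circuits produces, from the encrypted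
question `χ` and zeros, a state whose output wires are measured to give `α`; and for each `y` such a
family, using `m lam` fresh ancillas, implements `{N_{b|y}}_b` by measuring `b` on wire `0`. -/
def IsQPT (G : Set GateMatrix) (E : EncryptionScheme)
    (M : (lam : ℕ) → CompiledModel (E.ctLen lam) (E.ansLen lam)) : Prop :=
  (∀ lam, E.ctLen lam ≤ (M lam).n ∧ E.ansLen lam ≤ (M lam).n) ∧
  (∃ C : ℕ → List (G × ℕ × ℕ), LogspaceUniform (fun lam => (M lam).n) E.ansLen C ∧
    ∀ lam χ α, (M lam).state χ α =
      proj (fun s => ∀ i : Fin (E.ansLen lam), readWire s i = α i)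
        (runCircuit (C lam) (inputKet (M lam).n χ))) ∧
  (∀ y : Bool, ∃ (m : ℕ → ℕ) (C : ℕ → List (G × ℕ × ℕ)),
    LogspaceUniform (fun lam => (M lam).n + m lam) (fun _ => 1) C ∧
    ∀ (lam : ℕ) (b : Bool) (ψ : Qubits (M lam).n),
      inner ℂ ψ ((M lam).N y b ψ) =
        ((‖proj (fun s => readWire s 0 = b)
          (runCircuit (C lam) (padZeros (m lam) ψ))‖ ^ 2 : ℝ) : ℂ))

/-- The distribution `p(a,b|x,y)` of the decrypted first answer and the second answer. -/
def compiledProb (E : EncryptionScheme) (lam : ℕ)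
    (M : CompiledModel (E.ctLen lam) (E.ansLen lam)) (a b x y : Bool) : ℝ :=
  ∑ sk, (E.Gen lam sk).toReal * ∑ χ, (E.Enc lam sk x χ).toReal *
    ∑ α, (E.Dec lam sk α a).toReal * (inner ℂ (M.state χ α) (M.N y b (M.state χ α))).re

/-- The value of the compiled Bell functional with coefficients `w_{abxy}`. -/
def compiledValue (E : EncryptionScheme) (w : Bool → Bool → Bool → Bool → ℝ) (lam : ℕ)
    (M : CompiledModel (E.ctLen lam) (E.ansLen lam)) : ℝ :=
  ∑ a, ∑ b, ∑ x, ∑ y, w a b x y * compiledProb E lam M a b x y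

/-- `(-1) ^ b` -/
def boolSign (b : Bool) : ℝ := if b then -1 else 1

/-- Coefficients `w_{abxy}` of the extended tilted-CHSH functional of the operator
`A₀ (B₀ + B₁) / cos φ + τ² (sin 2θ A₁ (B₀ - B₁) / sin φ + cos 2θ (B₀ + B₁) / cos φ)`,
where `A_x = ∑ a, (-1)^a M_{a|x}` and `B_y = ∑ b, (-1)^b N_{b|y}`. The expectation of `B_y` alone is
taken with the first question distributed according to `q`. -/
def tiltedCoeff (θ φ τ : ℝ) (q : PMF Bool) (a b x y : Bool) : ℝ :=
  (if x = false then boolSign a * boolSign b / Real.cos φ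
    else τ ^ 2 * (Real.sin (2 * θ) * (boolSign a * (boolSign y * boolSign b) / Real.sin φ)))
  + (q x).toReal * (τ ^ 2 * (Real.cos (2 * θ) * (boolSign b / Real.cos φ)))

end

/-! Let `B_y` be the observable `Z` on wire `0` conjugated by the second-round circuit for `y`,
acting on the first-round state `ψ` padded with zeros; the ancillas make it a genuine ±1 observable.
Put S, C = sin φ, cos φ and s, c = sin 2θ, cos 2θ, and let `±` be the sign of the decrypted answer.
The bound comes from averaging two squares, `‖ψ ∓ (B₀+B₁)ψ/(2C)‖²` on question 0 and `τ²‖ψ ∓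
s(B₀-B₁)ψ/(2S) - c(B₀+B₁)ψ/(2C)‖²` on question 1. Expanded, they contain the terms of the
functional, constants, and the averages `G_x` of `Re⟨B₀ψ, B₁ψ⟩` under question `x`. The relation
defining τ makes the constants add up to `2(1+τ²)` and gives `G₀` and `G₁` opposite coefficients.

If second-round statistics could not depend on the question, this would be the quantum bound. Here
an error `(G₀-G₁)/(2C²) + τ²(c/C) q(0)(m₀-m₁)` remains, where `m_x` is the average of `⟨B₀+B₁⟩`
under question `x` (`tilted_sum_of_squares`, `compiledValue_tilted_le`). Security makes it
negligible once both kinds of averages are affine functions of acceptance probabilities of efficient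
adversaries. For `m_x` the adversary runs the model. For `G_x` it measures `B₀`, undoes its circuit,
measures `B₁` and outputs the parity: for projective measurements, the correlation of successive
outcomes is exactly `Re⟨B₀ψ, B₁ψ⟩` (`bias_quadratic_form_nonneg`, `projZero_parityCircuit`).

Two matters of the machine model remain. Measuring the encrypted answer in the middle of a circuit
is done by oracle calls with discarded replies (`acceptProb_sweep`). The adversary must also be
logspace uniform; inverse circuits are written in logarithmic space by rerunning the original
program once for every instruction (`Exec.backward`), and `Emits.logspaceUniform` assembles the
pieces. -/

noncomputable section

/-! ### Programs -/

section Programs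

variable {τ σ : Type}

theorem Exec.mono {B B' : ℕ} (hB : B ≤ B') {p : Prog τ} {s s' : ℕ → ℕ} {o : List (τ × ℕ × ℕ)}
    (h : Exec B p s o s') : Exec B' p s o s' := by
  induction h with
  | skip s => exact .skip s
  | zero s i => exact .zero s i
  | copy s i j => exact .copy s i j
  | inc s i h => exact .inc s i (h.trans hB)
  | dec s i => exact .dec s i
  | emit s t i j => exact .emit s t i j
  | seq _ _ ih ih' => exact .seq ih ih'
  | ifTrue h _ ih => exact .ifTrue h ih
  | ifFalse h _ ih => exact .ifFalse h ih
  | whileStop h => exact .whileStop h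
  | whileStep h _ _ ih ih' => exact .whileStep h ih ih'

/-- Register contents stay below any bound that dominates the initial contents and `B`. -/
theorem Exec.le_bound {B b : ℕ} (hB : B ≤ b) {p : Prog τ} {s s' : ℕ → ℕ}
    {o : List (τ × ℕ × ℕ)} (h : Exec B p s o s') : (∀ i, s i ≤ b) → ∀ i, s' i ≤ b := by
  induction h with
  | skip s => exact id
  | zero s i =>
    intro hs k; rcases eq_or_ne k i with rfl | hk <;> simp [*]
  | copy s i j =>
    intro hs k; rcases eq_or_ne k i with rfl | hk <;> simp [*]
  | inc s i h =>
    intro hs k; rcases eq_or_ne k i with rfl | hk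
    · simpa using h.trans hB
    · simp [*]
  | dec s i =>
    intro hs k; rcases eq_or_ne k i with rfl | hk
    · simpa using (hs k).trans (Nat.le_succ b)
    · simp [*]
  | emit s t i j => exact id
  | seq _ _ ih ih' => exact fun hs => ih' (ih hs)
  | ifTrue h _ ih => exact ih
  | ifFalse h _ ih => exact ih
  | whileStop h => exact id
  | whileStep h _ _ ih ih' => exact fun hs => ih' (ih hs)

namespace Prog

/-- The registers that a program may modify. -/
def targets : Prog τ → List ℕ
  | skip => []
  | zero i => [i]
  | copy i _ => [i]
  | inc i => [i]
  | dec i => [i]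
  | emit _ _ _ => []
  | seq p q => targets p ++ targets q
  | ifEq _ _ p q => targets p ++ targets q
  | whileNe _ _ p => targets p

/-- Set the listed registers to zero. -/
def clear : List ℕ → Prog τ
  | [] => skip
  | i :: l => seq (zero i) (clear l)

/-- Shift all registers by `K` and replace the output instructions by programs. -/
def relocate (K : ℕ) (e : τ → ℕ → ℕ → Prog σ) : Prog τ → Prog σ
  | skip => skip
  | zero i => zero (i + K)
  | copy i j => copy (i + K) (j + K)
  | inc i => inc (i + K)
  | dec i => dec (i + K)
  | emit t i j => e t (i + K) (j + K)
  | seq p q => seq (relocate K e p) (relocate K e q)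
  | ifEq i j p q => ifEq (i + K) (j + K) (relocate K e p) (relocate K e q)
  | whileNe i j p => whileNe (i + K) (j + K) (relocate K e p)

end Prog

theorem Exec.eq_of_notMem_targets {B : ℕ} {p : Prog τ} {s s' : ℕ → ℕ} {o : List (τ × ℕ × ℕ)}
    (h : Exec B p s o s') : ∀ {i : ℕ}, i ∉ p.targets → s' i = s i := by
  induction h with
  | skip s => intros; rfl
  | zero s i => intro k hk; simp_all [Prog.targets]
  | copy s i j => intro k hk; simp_all [Prog.targets]
  | inc s i h => intro k hk; simp_all [Prog.targets]
  | dec s i => intro k hk; simp_all [Prog.targets]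
  | emit s t i j => intros; rfl
  | seq _ _ ih ih' =>
    intro k hk
    simp only [Prog.targets, List.mem_append, not_or] at hk
    rw [ih' hk.2, ih hk.1]
  | ifTrue h _ ih =>
    intro k hk
    simp only [Prog.targets, List.mem_append, not_or] at hk
    exact ih hk.1
  | ifFalse h _ ih =>
    intro k hk
    simp only [Prog.targets, List.mem_append, not_or] at hk
    exact ih hk.2
  | whileStop h => intros; rfl
  | whileStep h _ _ ih ih' =>
    intro k hk
    rw [ih' hk, ih hk]

theorem Exec.clear (B : ℕ) (l : List ℕ) (s : ℕ → ℕ) :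
    Exec B (Prog.clear l : Prog τ) s [] (fun i => if i ∈ l then 0 else s i) := by
  induction l generalizing s with
  | nil => simpa [Prog.clear] using Exec.skip s
  | cons i l ih =>
    have h := Exec.seq (Exec.zero (B := B) (τ := τ) s i) (ih (Function.update s i 0))
    rw [List.nil_append] at h
    unfold Prog.clear
    convert h using 1
    funext k
    by_cases hk : k ∈ l
    · simp [hk]
    · by_cases hki : k = i <;> simp [hk, hki]

/-- The registers from `K` on taken from `s`, the others from `S`. -/
def splice (K : ℕ) (s S : ℕ → ℕ) : ℕ → ℕ := fun i => if K ≤ i then s (i - K) else S i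

@[simp] theorem splice_add (K : ℕ) (s S : ℕ → ℕ) (i : ℕ) : splice K s S (i + K) = s i := by
  simp [splice]

theorem splice_of_lt {K : ℕ} (s S : ℕ → ℕ) {i : ℕ} (h : i < K) : splice K s S i = S i := by
  simp [splice, h]

theorem update_splice_add (K : ℕ) (s S : ℕ → ℕ) (i v : ℕ) :
    Function.update (splice K s S) (i + K) v = splice K (Function.update s i v) S := by
  funext k
  simp only [splice, Function.update_apply]
  by_cases hk : K ≤ k
  · have : k = i + K ↔ k - K = i := by omega
    simp [hk, this]
  · have : k ≠ i + K := by omega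
    simp [hk, this]

theorem update_splice_of_lt {K : ℕ} (s S : ℕ → ℕ) {i : ℕ} (h : i < K) (v : ℕ) :
    Function.update (splice K s S) i v = splice K s (Function.update S i v) := by
  funext k
  simp only [splice, Function.update_apply]
  by_cases hk : K ≤ k
  · have : k ≠ i := by omega
    simp [hk, this]
  · simp [hk]

/-- The output of a relocated program whose output instructions count themselves in a register. -/
def taggedOutput (g : ℕ → ℕ → τ × ℕ × ℕ → List (σ × ℕ × ℕ)) (T : ℕ) :
    ℕ → List (τ × ℕ × ℕ) → List (σ × ℕ × ℕ)
  | _, [] => []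
  | k, x :: o => g (k + 1) T x ++ taggedOutput g T (k + 1) o

theorem taggedOutput_append (g : ℕ → ℕ → τ × ℕ × ℕ → List (σ × ℕ × ℕ)) (T k : ℕ)
    (o o' : List (τ × ℕ × ℕ)) :
    taggedOutput g T k (o ++ o') = taggedOutput g T k o ++ taggedOutput g T (k + o.length) o' := by
  induction o generalizing k with
  | nil => simp [taggedOutput]
  | cons x o ih => simp [taggedOutput, ih, Nat.add_assoc, Nat.add_comm 1]

/-- A simulation argument: registers from `K` on follow the original run, and below `K` only the
counter moves, by one per output instruction. Hence the output depends on the original instruction,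
its position and the fixed target alone. -/
theorem Exec.relocate {B K cnt tgt : ℕ} (hcnt : cnt < K) (htgt : tgt < K) (hne : tgt ≠ cnt)
    {e : τ → ℕ → ℕ → Prog σ} {g : ℕ → ℕ → τ × ℕ × ℕ → List (σ × ℕ × ℕ)}
    (he : ∀ t i j (s : ℕ → ℕ), s cnt + 1 ≤ B →
      Exec B (e t (i + K) (j + K)) s (g (s cnt + 1) (s tgt) (t, s (i + K), s (j + K)))
        (Function.update s cnt (s cnt + 1)))
    {p : Prog τ} {s s' : ℕ → ℕ} {o : List (τ × ℕ × ℕ)} (h : Exec B p s o s') :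
    ∀ S : ℕ → ℕ, S cnt + o.length ≤ B →
      Exec B (p.relocate K e) (splice K s S) (taggedOutput g (S tgt) (S cnt) o)
        (splice K s' (Function.update S cnt (S cnt + o.length))) := by
  induction h with
  | skip s => intro S _; simpa [Prog.relocate, taggedOutput] using Exec.skip _
  | zero s i =>
    intro S _
    have := Exec.zero (B := B) (τ := σ) (splice K s S) (i + K)
    rw [update_splice_add] at this
    simpa [Prog.relocate, taggedOutput] using this
  | copy s i j =>
    intro S _
    have := Exec.copy (B := B) (τ := σ) (splice K s S) (i + K) (j + K)
    rw [update_splice_add] at this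
    simpa [Prog.relocate, taggedOutput] using this
  | inc s i h =>
    intro S _
    have := Exec.inc (B := B) (τ := σ) (splice K s S) (i + K) (by simpa using h)
    rw [update_splice_add] at this
    simpa [Prog.relocate, taggedOutput] using this
  | dec s i =>
    intro S _
    have := Exec.dec (B := B) (τ := σ) (splice K s S) (i + K)
    rw [update_splice_add] at this
    simpa [Prog.relocate, taggedOutput] using this
  | emit s t i j =>
    intro S hS
    have := he t i j (splice K s S) (by simpa [splice_of_lt _ _ hcnt] using hS)
    rw [update_splice_of_lt _ _ hcnt] at this
    simpa [splice_of_lt _ _ hcnt, splice_of_lt _ _ htgt, taggedOutput, Prog.relocate] using this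
  | @seq p q s s' s'' o o' _ _ ih ih' =>
    intro S hS
    rw [List.length_append] at hS
    have h1 := ih S (by omega)
    have h2 := ih' (Function.update S cnt (S cnt + o.length)) (by simp; omega)
    have := Exec.seq h1 h2
    simpa [Prog.relocate, Function.update_of_ne hne, taggedOutput_append, Nat.add_assoc] using this
  | ifTrue h _ ih => intro S hS; exact .ifTrue (by simpa using h) (ih S hS)
  | ifFalse h _ ih => intro S hS; exact .ifFalse (by simpa using h) (ih S hS)
  | whileStop h =>
    intro S hS
    simpa [Prog.relocate, taggedOutput] using
      Exec.whileStop (B := B) (s := splice K _ S) (by simpa using h)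
  | @whileStep i j p s s' s'' o o' h _ _ ih ih' =>
    intro S hS
    rw [List.length_append] at hS
    have h1 := ih S (by omega)
    have h2 := ih' (Function.update S cnt (S cnt + o.length)) (by simp; omega)
    have := Exec.whileStep (i := i + K) (j := j + K) (by simpa using h) h1 h2
    simpa [Prog.relocate, Function.update_of_ne hne, taggedOutput_append, Nat.add_assoc] using this

/-- The initial register contents on input `lam`. -/
def initRegs (lam : ℕ) : ℕ → ℕ := fun i => if i = 0 then lam else 0

namespace Prog

/-- Run `p` on the contents of register `0` in the scratch area from register `8` on, return the
contents of its registers `0` and `1` in the registers `1` and `2`, and clean up. -/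
def call (e : τ → ℕ → ℕ → Prog σ) (p : Prog τ) : Prog σ :=
  seq (copy 8 0) <| seq (relocate 8 e p) <| seq (copy 1 8) <| seq (copy 2 9) <|
    clear (8 :: p.targets.map (· + 8))

/-- Count an instruction in register `3` and write it. -/
def emitAll (f : τ → σ) (t : τ) (i j : ℕ) : Prog σ := seq (inc 3) (emit (f t) i j)

/-- Count an instruction in register `3` and write it if the count agrees with register `4`. -/
def emitPick (f : τ → σ) (t : τ) (i j : ℕ) : Prog σ :=
  seq (inc 3) (ifEq 3 4 (emit (f t) i j) skip)

end Prog

theorem Exec.call {B lam : ℕ} {e : τ → ℕ → ℕ → Prog σ}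
    {g : ℕ → ℕ → τ × ℕ × ℕ → List (σ × ℕ × ℕ)}
    (he : ∀ t i j (s : ℕ → ℕ), s 3 + 1 ≤ B →
      Exec B (e t (i + 8) (j + 8)) s (g (s 3 + 1) (s 4) (t, s (i + 8), s (j + 8)))
        (Function.update s 3 (s 3 + 1)))
    {p : Prog τ} {s' : ℕ → ℕ} {o : List (τ × ℕ × ℕ)} (h : Exec B p (initRegs lam) o s')
    {S : ℕ → ℕ} (hS : ∀ i, 8 ≤ i → S i = 0) (h0 : S 0 = lam) (hlen : S 3 + o.length ≤ B) :
    Exec B (Prog.call e p) S (taggedOutput g (S 4) (S 3) o)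
      (Function.update (Function.update (Function.update S 3 (S 3 + o.length)) 1 (s' 0))
        2 (s' 1)) := by
  have h1 := Exec.relocate (K := 8) (cnt := 3) (tgt := 4) (by norm_num) (by norm_num)
    (by norm_num) he h S hlen
  -- The scratch area is zero, so copying the input to register 8 creates exactly the shifted
  -- initial configuration.
  have h2 : Exec B (Prog.copy 8 0 : Prog σ) S [] (splice 8 (initRegs lam) S) := by
    convert Exec.copy S 8 0 using 1
    funext i
    simp only [splice, initRegs, Function.update_apply]
    by_cases hi : i = 8
    · simp [hi, h0]
    · by_cases h8 : 8 ≤ i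
      · have : i - 8 ≠ 0 := by omega
        simp [hi, h8, this, hS]
      · simp [h8, hi]
  have h3 := Exec.seq h2 (Exec.seq h1 (Exec.seq (Exec.copy _ 1 8) (Exec.seq (Exec.copy _ 2 9)
    (Exec.clear B (8 :: p.targets.map (· + 8)) _))))
  simp only [List.nil_append, List.append_nil] at h3
  unfold Prog.call
  convert h3 using 1
  funext i
  -- Registers the program cannot modify still hold their initial zeros; clearing its targets and
  -- the input cell therefore restores the scratch area, and `p` can be called again.
  have hf : ∀ k, k ≠ 0 → k ∉ p.targets → s' k = 0 := fun k hk hk' => by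
    rw [h.eq_of_notMem_targets hk']; simp [initRegs, hk]
  by_cases h8 : 8 ≤ i
  · have e1 : i ≠ 1 := by omega
    have e2 : i ≠ 2 := by omega
    have e3 : i ≠ 3 := by omega
    simp only [Function.update_apply, e1, e2, e3, if_false, hS i h8]
    split_ifs with hm
    · rfl
    · obtain ⟨k, rfl⟩ := Nat.exists_eq_add_of_le' h8
      rw [splice_add]
      simp only [List.mem_cons, List.mem_map, not_or] at hm
      refine (hf k (by omega) fun hk => hm.2 ⟨k, hk, rfl⟩).symm
  · have hm : i ∉ 8 :: p.targets.map (· + 8) := by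
      simp only [List.mem_cons, List.mem_map, not_or, not_exists, not_and]
      refine ⟨by omega, fun k _ => by omega⟩
    simp only [hm, if_false]
    have a8 : splice 8 s' (Function.update S 3 (S 3 + o.length)) 8 = s' 0 := splice_add 8 _ _ 0
    have a9 : splice 8 s' (Function.update S 3 (S 3 + o.length)) 9 = s' 1 := splice_add 8 _ _ 1
    simp only [Function.update_apply, a8, a9]
    simp [splice_of_lt _ _ (not_le.1 h8), Function.update_apply]

theorem exec_emitAll (B : ℕ) (f : τ → σ) (t : τ) (i j : ℕ) (s : ℕ → ℕ) (h : s 3 + 1 ≤ B) :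
    Exec B (Prog.emitAll f t (i + 8) (j + 8)) s [(f t, s (i + 8), s (j + 8))]
      (Function.update s 3 (s 3 + 1)) := by
  have := Exec.seq (Exec.inc s 3 h) (Exec.emit _ (f t) (i + 8) (j + 8))
  simpa [Prog.emitAll, Function.update_apply] using this

/-- Apply a function to the symbol of an instruction. -/
def mapOp (f : τ → σ) (x : τ × ℕ × ℕ) : σ × ℕ × ℕ := (f x.1, x.2)

theorem exec_emitPick (B : ℕ) (f : τ → σ) (t : τ) (i j : ℕ) (s : ℕ → ℕ) (h : s 3 + 1 ≤ B) :
    Exec B (Prog.emitPick f t (i + 8) (j + 8)) s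
      (if s 3 + 1 = s 4 then [mapOp f (t, s (i + 8), s (j + 8))] else [])
      (Function.update s 3 (s 3 + 1)) := by
  by_cases h4 : s 3 + 1 = s 4
  · rw [if_pos h4]
    refine Exec.seq (o := []) (Exec.inc s 3 h) ?_
    refine Exec.ifTrue (by simpa [Function.update_apply] using h4) ?_
    have := Exec.emit (B := B) (Function.update s 3 (s 3 + 1)) (f t) (i + 8) (j + 8)
    simpa [Function.update_apply, mapOp] using this
  · rw [if_neg h4]
    refine Exec.seq (o := []) (Exec.inc s 3 h) ?_
    exact Exec.ifFalse (by simpa [Function.update_apply] using h4) (Exec.skip _)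

theorem taggedOutput_all (f : τ → σ) (T k : ℕ) (o : List (τ × ℕ × ℕ)) :
    taggedOutput (fun _ _ x => [mapOp f x]) T k o = o.map (mapOp f) := by
  induction o generalizing k with
  | nil => rfl
  | cons x o ih => simp [taggedOutput, ih]

/-- The instruction picked from a list, if any. -/
def pickOutput (f : τ → σ) (T k : ℕ) (o : List (τ × ℕ × ℕ)) : List (σ × ℕ × ℕ) :=
  taggedOutput (fun k T x => if k = T then [mapOp f x] else []) T k o

theorem pickOutput_of_le (f : τ → σ) {T k : ℕ} (h : T ≤ k) (o : List (τ × ℕ × ℕ)) :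
    pickOutput f T k o = [] := by
  induction o generalizing k with
  | nil => rfl
  | cons x o ih =>
    have : k + 1 ≠ T := by omega
    have h' := ih (k := k + 1) (by omega)
    unfold pickOutput at h' ⊢
    simp [taggedOutput, this, h']

theorem pickOutput_succ (f : τ → σ) {T k : ℕ} (o : List (τ × ℕ × ℕ)) (h : T < o.length) :
    pickOutput f (k + T + 1) k o = [mapOp f o[T]] := by
  induction o generalizing k T with
  | nil => simp at h
  | cons x o ih =>
    rcases T with _ | T
    · have h' := pickOutput_of_le f (le_refl (k + 1)) o
      unfold pickOutput at h' ⊢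
      simp [taggedOutput, h']
    · have h' := ih (k := k + 1) (T := T) (by simpa using h)
      have e : k + 1 + T + 1 = k + (T + 1) + 1 := by omega
      rw [e] at h'
      unfold pickOutput at h' ⊢
      simp [taggedOutput, h']

/-- Write the output of `p` with the symbols mapped by `f`. -/
def Prog.forward (f : τ → σ) (p : Prog τ) : Prog σ :=
  Prog.seq (Prog.zero 3) (Prog.call (Prog.emitAll f) p)

/-- Run `p` without writing anything; its output is counted in register `3`. -/
def Prog.silent (f : τ → σ) (p : Prog τ) : Prog σ :=
  Prog.seq (Prog.zero 3) (Prog.seq (Prog.zero 4) (Prog.call (Prog.emitPick f) p))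

/-- Write the output of `p` in reverse order with the symbols mapped by `f`. -/
def Prog.backward (f : τ → σ) (p : Prog τ) : Prog σ :=
  Prog.seq (Prog.silent f p) <| Prog.seq (Prog.copy 4 3) <|
    Prog.whileNe 4 7 <| Prog.seq (Prog.zero 3) <|
      Prog.seq (Prog.call (Prog.emitPick f) p) (Prog.dec 4)

/-- Registers between the pieces of a composite program: the input `lam` in register `0`, the wire
numbers `w` and `w + 1` in registers `5` and `6`, zero in register `7` and in the scratch area. -/
structure Env (w lam : ℕ) (s : ℕ → ℕ) : Prop where
  scratch : ∀ i, 8 ≤ i → s i = 0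
  input : s 0 = lam
  fst : s 5 = w
  snd : s 6 = w + 1
  zero : s 7 = 0

theorem Env.congr {w lam : ℕ} {s s' : ℕ → ℕ} (h : Env w lam s)
    (hs : ∀ i, i = 0 ∨ 5 ≤ i → s' i = s i) : Env w lam s' :=
  ⟨fun i hi => by rw [hs i (by omega), h.scratch i hi], by rw [hs 0 (by omega), h.input],
    by rw [hs 5 (by omega), h.fst], by rw [hs 6 (by omega), h.snd], by rw [hs 7 (by omega), h.zero]⟩

theorem Exec.forward {B lam : ℕ} (f : τ → σ) {p : Prog τ} {s' : ℕ → ℕ} {o : List (τ × ℕ × ℕ)}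
    (h : Exec B p (initRegs lam) o s') (hlen : o.length ≤ B)
    {S : ℕ → ℕ} (hS : ∀ i, 8 ≤ i → S i = 0) (h0 : S 0 = lam) :
    ∃ S', Exec B (Prog.forward f p) S (o.map (mapOp f)) S' ∧ S' 1 = s' 0 ∧ S' 2 = s' 1 ∧
      ∀ i, i = 0 ∨ 5 ≤ i → S' i = S i := by
  have h1 := Exec.call (e := Prog.emitAll f) (g := fun _ _ x => [mapOp f x])
    (fun t i j s hs => exec_emitAll B f t i j s hs) h
    (S := Function.update S 3 0) (fun i hi => by
      rw [Function.update_of_ne (by omega), hS i hi]) (by simpa using h0) (by simpa using hlen)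
  rw [taggedOutput_all] at h1
  refine ⟨_, Exec.seq (o := []) (Exec.zero S 3) h1, by simp, by simp, fun i hi => ?_⟩
  rw [Function.update_of_ne (by omega), Function.update_of_ne (by omega),
    Function.update_of_ne (by omega), Function.update_of_ne (by omega)]

theorem Exec.silent {B lam : ℕ} (f : τ → σ) {p : Prog τ} {s' : ℕ → ℕ} {o : List (τ × ℕ × ℕ)}
    (h : Exec B p (initRegs lam) o s') (hlen : o.length ≤ B)
    {S : ℕ → ℕ} (hS : ∀ i, 8 ≤ i → S i = 0) (h0 : S 0 = lam) :
    ∃ S', Exec B (Prog.silent f p) S [] S' ∧ S' 1 = s' 0 ∧ S' 2 = s' 1 ∧ S' 3 = o.length ∧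
      ∀ i, i = 0 ∨ 5 ≤ i → S' i = S i := by
  have h1 := Exec.call (e := Prog.emitPick f)
    (g := fun k T x => if k = T then [mapOp f x] else [])
    (fun t i j s hs => exec_emitPick B f t i j s hs) h
    (S := Function.update (Function.update S 3 0) 4 0) (fun i hi => by
      rw [Function.update_of_ne (by omega), Function.update_of_ne (by omega), hS i hi])
    (by simpa using h0) (by simpa using hlen)
  -- Counts are compared after incrementing, so they start at 1 and target 0 selects nothing.
  have h2 := pickOutput_of_le f (le_refl 0) o
  unfold pickOutput at h2
  simp only [Function.update_self, ne_eq, Nat.reduceEqDiff,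
    not_false_eq_true, Function.update_of_ne, h2] at h1
  refine ⟨_, Exec.seq (o := []) (Exec.zero S 3) (Exec.seq (o := []) (Exec.zero _ 4) h1),
    by simp, by simp, by simp, fun i hi => ?_⟩
  rw [Function.update_of_ne (by omega), Function.update_of_ne (by omega),
    Function.update_of_ne (by omega), Function.update_of_ne (by omega),
    Function.update_of_ne (by omega)]

/-- The output is too long to be stored. Its length is counted in a silent run, then `p` is rerun
once per position, from last to first, and only the instruction at that position is written. -/
theorem Exec.backward {B lam : ℕ} (f : τ → σ) {p : Prog τ} {s' : ℕ → ℕ} {o : List (τ × ℕ × ℕ)}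
    (h : Exec B p (initRegs lam) o s') (hlen : o.length ≤ B)
    {S : ℕ → ℕ} (hS : ∀ i, 8 ≤ i → S i = 0) (h0 : S 0 = lam) (h7 : S 7 = 0) :
    ∃ S', Exec B (Prog.backward f p) S (o.reverse.map (mapOp f)) S' ∧
      ∀ i, i = 0 ∨ 5 ≤ i → S' i = S i := by
  have loop : ∀ (T : ℕ), T ≤ o.length → ∀ S : ℕ → ℕ, (∀ i, 8 ≤ i → S i = 0) → S 0 = lam →
      S 7 = 0 → S 4 = T → ∃ S', Exec B (Prog.whileNe 4 7 <| Prog.seq (Prog.zero 3) <|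
        Prog.seq (Prog.call (Prog.emitPick f) p) (Prog.dec 4)) S
          ((o.take T).reverse.map (mapOp f)) S' ∧ ∀ i, i = 0 ∨ 5 ≤ i → S' i = S i := by
    intro T
    induction T with
    | zero =>
      intro _ S _ _ h7 h4
      exact ⟨S, by simpa using Exec.whileStop (by rw [h4, h7]), fun _ _ => rfl⟩
    | succ T ih =>
      intro hT S hS h0 h7 h4
      have h1 := Exec.call (e := Prog.emitPick f)
        (g := fun k T x => if k = T then [mapOp f x] else [])
        (fun t i j s hs => exec_emitPick B f t i j s hs) h
        (S := Function.update S 3 0) (fun i hi => by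
          rw [Function.update_of_ne (by omega), hS i hi]) (by simpa using h0) (by simpa using hlen)
      -- Targets count from 1 and list positions from 0: target `T + 1` selects `o[T]`, the head of
      -- the reversal of the first `T + 1` instructions.
      have h2 := pickOutput_succ f (T := T) (k := 0) o (by omega)
      rw [Nat.zero_add] at h2
      unfold pickOutput at h2
      simp only [Function.update_self, ne_eq, Nat.reduceEqDiff,
        not_false_eq_true, Function.update_of_ne, h4, h2] at h1
      have key : ∃ S₂, Exec B (Prog.seq (Prog.zero 3) <|
          Prog.seq (Prog.call (Prog.emitPick f) p) (Prog.dec 4)) S [mapOp f o[T]] S₂ ∧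
          S₂ 4 = T ∧ ∀ i, i = 0 ∨ 5 ≤ i → S₂ i = S i := by
        refine ⟨_, Exec.seq (o := []) (Exec.zero S 3) (Exec.seq (o' := []) h1 (Exec.dec _ 4)),
          by simp [h4], fun i hi => ?_⟩
        rw [Function.update_of_ne (by omega), Function.update_of_ne (by omega),
            Function.update_of_ne (by omega), Function.update_of_ne (by omega),
            Function.update_of_ne (by omega)]
      obtain ⟨S₂, h3, h24, hS2⟩ := key
      obtain ⟨S', hE, hS'⟩ := ih (by omega) S₂ (fun i hi => by
          rw [hS2 i (by omega), hS i hi]) (by rw [hS2 0 (by omega), h0])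
          (by rw [hS2 7 (by omega), h7]) h24
      refine ⟨S', ?_, fun i hi => by rw [hS' i hi, hS2 i hi]⟩
      have := Exec.whileStep (i := 4) (j := 7) (by rw [h4, h7]; omega) h3 hE
      rwa [List.take_add_one, List.getElem?_eq_getElem (by omega : T < o.length),
        Option.toList_some, List.reverse_append, List.map_append]
  obtain ⟨S₁, e1, -, -, hS3, hS1⟩ := Exec.silent f h hlen hS h0
  obtain ⟨S₂, e2, hS2⟩ := loop o.length le_rfl (Function.update S₁ 4 (S₁ 3)) (fun i hi => by
    rw [Function.update_of_ne (by omega), hS1 i (by omega), hS i hi])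
    (by simp [hS1, h0]) (by simp [hS1, h7]) (by simpa using hS3)
  refine ⟨S₂, ?_, fun i hi => ?_⟩
  · simpa [Prog.backward] using Exec.seq e1 (Exec.seq (Exec.copy _ 4 3) e2)
  · rw [hS2 i hi, Function.update_of_ne (by omega), hS1 i hi]

/-! ### Assembling uniform circuit families from pieces -/

/-- Programs that write `D lam` in the environment `Env (w lam) lam`. -/
def Emits (w : ℕ → ℕ) (D : ℕ → List (σ × ℕ × ℕ)) : Prop :=
  ∃ (q : Prog σ) (c : ℕ), ∀ lam, (D lam).length ≤ (lam + 2) ^ c ∧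
    ∀ s, Env (w lam) lam s → ∃ s', Exec ((lam + 2) ^ c) q s (D lam) s' ∧ Env (w lam) lam s'

theorem pow_le_pow_add_two {c d : ℕ} (h : c ≤ d) (lam : ℕ) : (lam + 2) ^ c ≤ (lam + 2) ^ d :=
  Nat.pow_le_pow_right (by omega) h

theorem add_le_pow_max {a b c d lam : ℕ} (ha : a ≤ (lam + 2) ^ c) (hb : b ≤ (lam + 2) ^ d) :
    a + b ≤ (lam + 2) ^ (max c d + 1) := by
  have h1 := ha.trans (pow_le_pow_add_two (le_max_left c d) lam)
  have h2 := hb.trans (pow_le_pow_add_two (le_max_right c d) lam)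
  rw [pow_succ]
  nlinarith

theorem Emits.append {w : ℕ → ℕ} {D D' : ℕ → List (σ × ℕ × ℕ)} (h : Emits w D) (h' : Emits w D') :
    Emits w (fun lam => D lam ++ D' lam) := by
  obtain ⟨q, c, hq⟩ := h
  obtain ⟨q', c', hq'⟩ := h'
  refine ⟨q.seq q', max c c' + 1, fun lam => ⟨?_, fun s hs => ?_⟩⟩
  · rw [List.length_append]
    exact add_le_pow_max (hq lam).1 (hq' lam).1
  · obtain ⟨s₁, e₁, hs₁⟩ := (hq lam).2 s hs
    obtain ⟨s₂, e₂, hs₂⟩ := (hq' lam).2 s₁ hs₁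
    exact ⟨s₂, (e₁.mono (pow_le_pow_add_two (by omega) lam)).seq
      (e₂.mono (pow_le_pow_add_two (by omega) lam)), hs₂⟩

theorem Emits.op_fst (w : ℕ → ℕ) (t : σ) : Emits w (fun lam => [(t, 0, w lam)]) :=
  ⟨Prog.emit t 7 5, 0, fun lam => ⟨by simp, fun s hs =>
    ⟨s, by simpa [hs.zero, hs.fst] using Exec.emit (B := 1) s t 7 5, hs⟩⟩⟩

theorem Emits.fst_op (w : ℕ → ℕ) (t : σ) : Emits w (fun lam => [(t, w lam, 0)]) :=
  ⟨Prog.emit t 5 7, 0, fun lam => ⟨by simp, fun s hs =>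
    ⟨s, by simpa [hs.zero, hs.fst] using Exec.emit (B := 1) s t 5 7, hs⟩⟩⟩

theorem LogspaceUniform.emits {n r : ℕ → ℕ} {C : ℕ → List (τ × ℕ × ℕ)}
    (h : LogspaceUniform n r C) (w : ℕ → ℕ) (f : τ → σ) :
    Emits w (fun lam => (C lam).map (mapOp f)) := by
  obtain ⟨-, p, c, hp⟩ := h
  refine ⟨p.forward f, c, fun lam => ⟨by simpa using (hp lam).1, fun s hs => ?_⟩⟩
  obtain ⟨hlen, s', hE, -⟩ := hp lam
  obtain ⟨S', hE', -, -, hS'⟩ := Exec.forward f hE hlen hs.scratch hs.input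
  exact ⟨S', hE', hs.congr hS'⟩

theorem LogspaceUniform.emits_reverse {n r : ℕ → ℕ} {C : ℕ → List (τ × ℕ × ℕ)}
    (h : LogspaceUniform n r C) (w : ℕ → ℕ) (f : τ → σ) :
    Emits w (fun lam => (C lam).reverse.map (mapOp f)) := by
  obtain ⟨-, p, c, hp⟩ := h
  refine ⟨p.backward f, c, fun lam => ⟨by simpa using (hp lam).1, fun s hs => ?_⟩⟩
  obtain ⟨hlen, s', hE, -⟩ := hp lam
  obtain ⟨S', hE', hS'⟩ := Exec.backward f hE hlen hs.scratch hs.input hs.zero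
  exact ⟨S', hE', hs.congr hS'⟩

/-- The wire numbers are final register contents, hence obey the space bound. -/
theorem LogspaceUniform.exists_le_pow {n r : ℕ → ℕ} {C : ℕ → List (τ × ℕ × ℕ)}
    (h : LogspaceUniform n r C) : ∃ c, ∀ lam, n lam ≤ (lam + 2) ^ c ∧ r lam ≤ (lam + 2) ^ c := by
  obtain ⟨-, p, c, hp⟩ := h
  refine ⟨c + 1, fun lam => ?_⟩
  obtain ⟨-, s', hE, h0, h1⟩ := hp lam
  rw [← h0, ← h1]
  -- The exponent is raised to `c + 1` so that the bound also dominates the input `lam` when `c =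
  -- 0`.
  have := hE.le_bound (pow_le_pow_add_two (Nat.le_succ c) lam) (fun i => by
    split_ifs
    · rw [pow_succ]
      have := Nat.one_le_pow c (lam + 2) (by omega)
      nlinarith
    · exact Nat.zero_le _)
  exact ⟨this 0, this 1⟩

/-- The same two-wire instruction on each of the first `l` wires and wire `w + 1`. -/
def sweep (t : σ) (l w : ℕ) : List (σ × ℕ × ℕ) := (List.range l).map fun i => (t, i, w + 1)

theorem LogspaceUniform.emits_sweep {n r : ℕ → ℕ} {C : ℕ → List (τ × ℕ × ℕ)}
    (h : LogspaceUniform n r C) (w : ℕ → ℕ) (f : τ → σ) (t : σ) :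
    Emits w (fun lam => sweep t (r lam) (w lam)) := by
  obtain ⟨c', hc'⟩ := h.exists_le_pow
  obtain ⟨-, p, c, hp⟩ := h
  refine ⟨(p.silent f).seq <| (Prog.zero 3).seq <| Prog.whileNe 3 2 <|
    (Prog.emit t 3 6).seq (Prog.inc 3), max c c', fun lam => ⟨?_, fun s hs => ?_⟩⟩
  · simpa [sweep] using (hc' lam).2.trans (pow_le_pow_add_two (le_max_right c c') lam)
  have hr := (hc' lam).2.trans (pow_le_pow_add_two (le_max_right c c') lam)
  obtain ⟨hlen, s', hE, -, hs1⟩ := hp lam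
  obtain ⟨S', hE', -, hr2, -, hS'⟩ := Exec.silent f hE hlen hs.scratch hs.input
  -- Register 2 holds `r lam`, recovered by the silent run; register 3 is the running wire and `m`
  -- the number of wires left.
  have loop : ∀ m k, k + m = r lam → ∀ S : ℕ → ℕ, S 2 = r lam → S 3 = k → S 6 = w lam + 1 →
      ∃ S', Exec ((lam + 2) ^ max c c')
        (Prog.whileNe 3 2 <| (Prog.emit t 3 6).seq (Prog.inc 3)) S
        ((List.range' k m).map fun i => (t, i, w lam + 1)) S' ∧
        ∀ i, i = 0 ∨ 5 ≤ i → S' i = S i := by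
    intro m
    induction m with
    | zero => exact fun k hk S h2 h3 _ => ⟨S, Exec.whileStop (by omega), fun _ _ => rfl⟩
    | succ m ih =>
      intro k hk S h2 h3 h6
      obtain ⟨S', hE, hS'⟩ := ih (k + 1) (by omega) (Function.update S 3 (S 3 + 1))
        (by simpa using h2) (by simpa using h3) (by simpa using h6)
      have h1 := Exec.seq (Exec.emit (B := (lam + 2) ^ max c c') S t 3 6)
        (Exec.inc S 3 (by omega))
      refine ⟨S', ?_, fun i hi => by rw [hS' i hi, Function.update_of_ne (by omega)]⟩
      have := Exec.whileStep (i := 3) (j := 2) (by omega) h1 hE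
      simpa [List.range'_succ, h3, h6] using this
  obtain ⟨S'', hE'', hS''⟩ := loop (r lam) 0 (by omega) (Function.update S' 3 0)
    (by simpa using hr2.trans hs1) (by simp) (by simp [hS', hs.snd])
  refine ⟨S'', ?_, hs.congr fun i hi => by
    rw [hS'' i hi, Function.update_of_ne (by omega), hS' i hi]⟩
  simp only [sweep, List.range_eq_range']
  exact Exec.seq (o := []) (hE'.mono (pow_le_pow_add_two (le_max_left c c') lam))
    (Exec.seq (o := []) (Exec.zero _ 3) hE'')

/-- A family of circuits is logspace uniform when it is written by a program that is given wire
numbers computed by other logspace-uniform families. -/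
theorem Emits.logspaceUniform {n₀ n₁ r₀ r₁ : ℕ → ℕ} {C₀ C₁ : ℕ → List (τ × ℕ × ℕ)}
    (h₀ : LogspaceUniform n₀ r₀ C₀) (h₁ : LogspaceUniform n₁ r₁ C₁) (f : τ → σ)
    {D : ℕ → List (σ × ℕ × ℕ)} (hD : Emits (fun lam => n₀ lam + n₁ lam + 1) D)
    (hw : ∀ lam, ∀ op ∈ D lam, op.2.1 < n₀ lam + n₁ lam + 1 + 2 ∧
      op.2.2 < n₀ lam + n₁ lam + 1 + 2 ∧ op.2.1 ≠ op.2.2) :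
    LogspaceUniform (fun lam => n₀ lam + n₁ lam + 1 + 2) (fun _ => 1) D := by
  obtain ⟨b₀, hb₀⟩ := h₀.exists_le_pow
  obtain ⟨b₁, hb₁⟩ := h₁.exists_le_pow
  obtain ⟨-, p₀, c₀, hp₀⟩ := h₀
  obtain ⟨-, p₁, c₁, hp₁⟩ := h₁
  obtain ⟨q, c, hq⟩ := hD
  refine ⟨hw, (p₀.silent f).seq <| (Prog.copy 5 1).seq <| (p₁.silent f).seq <|
    (Prog.zero 3).seq <| (Prog.whileNe 3 1 <| (Prog.inc 3).seq (Prog.inc 5)).seq <|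
    ((Prog.inc 5).seq <| (Prog.copy 6 5).seq <| Prog.inc 6).seq <| q.seq <|
    (Prog.copy 0 6).seq <| (Prog.inc 0).seq <| (Prog.zero 1).seq <| Prog.inc 1,
    b₀ + b₁ + c₀ + c₁ + c + 3, fun lam => ?_⟩
  set B := (lam + 2) ^ (b₀ + b₁ + c₀ + c₁ + c + 3) with hB
  have hcB : (lam + 2) ^ c ≤ B := pow_le_pow_add_two (by omega) lam
  -- With `X` a power of `lam + 2` bounding `n₀ + n₁`, one has `X + 3 ≤ 4 X ≤ (lam + 2)² X`.
  have hwB : n₀ lam + n₁ lam + 1 + 2 ≤ B := by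
    have e := add_le_pow_max (hb₀ lam).1 (hb₁ lam).1
    have e' : n₀ lam + n₁ lam ≤ (lam + 2) ^ (b₀ + b₁ + 1) :=
      e.trans (pow_le_pow_add_two (by omega) lam)
    have e'' : (lam + 2) ^ (b₀ + b₁ + 1 + 2) ≤ B := pow_le_pow_add_two (by omega) lam
    rw [pow_add _ (b₀ + b₁ + 1) 2] at e''
    have e4 : 2 ^ 2 ≤ (lam + 2) ^ 2 := Nat.pow_le_pow_left (by omega) 2
    have e3 := Nat.one_le_pow (b₀ + b₁ + 1) (lam + 2) (by omega)
    nlinarith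
  obtain ⟨hlen₀, s₀, hE₀, hs₀, -⟩ := hp₀ lam
  obtain ⟨hlen₁, s₁, hE₁, hs₁, -⟩ := hp₁ lam
  have hl₀ := hlen₀.trans (pow_le_pow_add_two (by omega : c₀ ≤ b₀ + b₁ + c₀ + c₁ + c + 3) lam)
  have hl₁ := hlen₁.trans (pow_le_pow_add_two (by omega : c₁ ≤ b₀ + b₁ + c₀ + c₁ + c + 3) lam)
  replace hE₀ := hE₀.mono (pow_le_pow_add_two (by omega : c₀ ≤ b₀ + b₁ + c₀ + c₁ + c + 3) lam)
  replace hE₁ := hE₁.mono (pow_le_pow_add_two (by omega : c₁ ≤ b₀ + b₁ + c₀ + c₁ + c + 3) lam)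
  refine ⟨(hq lam).1.trans hcB, ?_⟩
  obtain ⟨S₁, e₁, a₁, -, -, f₁⟩ := Exec.silent f hE₀ hl₀ (S := initRegs lam)
    (fun i hi => by simp [initRegs, show i ≠ 0 by omega]) rfl
  obtain ⟨S₂, e₂, a₂, -, -, f₂⟩ := Exec.silent f hE₁ hl₁ (S := Function.update S₁ 5 (S₁ 1))
    (fun i hi => by rw [Function.update_of_ne (by omega), f₁ i (by omega)]
                    simp [initRegs, show i ≠ 0 by omega]) (by simp [f₁, initRegs])
  -- Addition by counting: register 5 starts at `n₀` and is incremented while register 3 climbs to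
  -- `n₁`, kept in register 1.
  have loop : ∀ m k, k + m = n₁ lam → ∀ S : ℕ → ℕ, S 1 = n₁ lam → S 3 = k →
      S 5 = n₀ lam + k → ∃ S', Exec B (Prog.whileNe 3 1 <| (Prog.inc 3).seq (Prog.inc 5) : Prog σ)
        S [] S' ∧ S' 5 = n₀ lam + n₁ lam ∧ ∀ i, i = 0 ∨ 6 ≤ i → S' i = S i := by
    intro m
    induction m with
    | zero => exact fun k hk S h1 h3 h5 => ⟨S, Exec.whileStop (by omega), by omega, fun _ _ => rfl⟩
    | succ m ih =>
      intro k hk S h1 h3 h5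
      obtain ⟨S', hE, h5', hS'⟩ := ih (k + 1) (by omega)
        (Function.update (Function.update S 3 (S 3 + 1)) 5 (S 5 + 1))
        (by simpa using h1) (by simpa using h3) (by simp [h5, Nat.add_assoc])
      have h1 := Exec.seq (τ := σ) (B := B) (Exec.inc S 3 (by omega))
        (Exec.inc (Function.update S 3 (S 3 + 1)) 5 (by simp; omega))
      refine ⟨S', ?_, h5', fun i hi => by
        rw [hS' i hi, Function.update_of_ne (by omega), Function.update_of_ne (by omega)]⟩
      exact Exec.whileStep (o := []) (i := 3) (j := 1) (by omega) h1 (by simpa using hE)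
  obtain ⟨S₃, e₃, a₃, f₃⟩ := loop (n₁ lam) 0 (by omega) (Function.update S₂ 3 0)
    (by simpa using a₂.trans hs₁) (by simp) (by simp [f₂, a₁, hs₀])
  have f₃' : ∀ i, i = 0 ∨ 6 ≤ i → S₃ i = initRegs lam i := fun i hi => by
    rw [f₃ i hi, Function.update_of_ne (by omega), f₂ i (by omega),
      Function.update_of_ne (by omega), f₁ i (by omega)]
  obtain ⟨S₄, e₄, h₄⟩ : ∃ S, Exec B ((Prog.inc 5).seq <| (Prog.copy 6 5).seq <|
      Prog.inc 6 : Prog σ) S₃ [] S ∧ Env (n₀ lam + n₁ lam + 1) lam S := by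
    refine ⟨_, Exec.seq (o := []) (Exec.inc _ 5 (by omega)) (Exec.seq (o := [])
      (Exec.copy _ 6 5) (Exec.inc _ 6 (by simp; omega))), fun i hi => ?_, ?_, ?_, ?_, ?_⟩
    · rw [Function.update_of_ne (by omega), Function.update_of_ne (by omega),
        Function.update_of_ne (by omega), f₃' i (by omega)]
      simp [initRegs, show i ≠ 0 by omega]
    · simp [f₃', initRegs]
    · simp [a₃]
    · simp [a₃]
    · simp [f₃', initRegs]
  obtain ⟨S₅, e₅, h₅⟩ := (hq lam).2 S₄ h₄
  obtain ⟨S₆, e₆, h₆, h₆'⟩ : ∃ S, Exec B ((Prog.copy 0 6).seq <| (Prog.inc 0).seq <|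
      (Prog.zero 1).seq <| Prog.inc 1 : Prog σ) S₅ [] S ∧
      S 0 = n₀ lam + n₁ lam + 1 + 2 ∧ S 1 = 1 := by
    refine ⟨_, Exec.seq (o := []) (Exec.copy _ 0 6) (Exec.seq (o := [])
      (Exec.inc _ 0 ?_) (Exec.seq (o := []) (Exec.zero _ 1) (Exec.inc _ 1 ?_))), ?_, ?_⟩
    · simp [h₅.snd]; omega
    · simp; omega
    · simp [h₅.snd]
    · simp
  refine ⟨S₆, ?_, h₆, h₆'⟩
  have := e₁.seq <| (Exec.copy _ 5 1).seq <| e₂.seq <| (Exec.zero _ 3).seq <| e₃.seq <|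
    e₄.seq <| (e₅.mono hcB).seq e₆
  simp only [List.nil_append, List.append_nil] at this
  exact this

end Programs

/-! ### Circuits -/

section Circuits

variable {n : ℕ}

/-- Overwrite the bits on the wires `a` and `b`. -/
def setPair (a b : Fin n) (p : Bool × Bool) (s : Fin n → Bool) : Fin n → Bool :=
  Function.update (Function.update s a p.1) b p.2

theorem setPair_setPair (a b : Fin n) (p q : Bool × Bool) (s : Fin n → Bool) :
    setPair a b p (setPair a b q s) = setPair a b p s := by
  funext i
  simp only [setPair, Function.update_apply]
  split_ifs <;> rfl

@[simp] theorem setPair_self (a b : Fin n) (s : Fin n → Bool) : setPair a b (s a, s b) s = s := by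
  simp [setPair]

@[simp] theorem setPair_snd (a b : Fin n) (p : Bool × Bool) (s : Fin n → Bool) :
    setPair a b p s b = p.2 := by simp [setPair]

theorem setPair_fst {a b : Fin n} (hab : a ≠ b) (p : Bool × Bool) (s : Fin n → Bool) :
    setPair a b p s a = p.1 := by simp [setPair, hab]

theorem applyGate_apply (g : GateMatrix) {a b : ℕ} (ha : a < n) (hb : b < n) (hab : a ≠ b)
    (ψ : Qubits n) (s : Fin n → Bool) :
    applyGate g a b ψ s = ∑ p : Bool × Bool, g (s ⟨a, ha⟩, s ⟨b, hb⟩) p *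
      ψ (setPair ⟨a, ha⟩ ⟨b, hb⟩ p s) := by
  simp [applyGate, ha, hb, hab, setPair]

theorem applyGate_add (g : GateMatrix) (a b : ℕ) (ψ φ : Qubits n) :
    applyGate g a b (ψ + φ) = applyGate g a b ψ + applyGate g a b φ := by
  by_cases h : a < n ∧ b < n ∧ a ≠ b
  · ext s
    simp only [PiLp.add_apply, applyGate_apply g h.1 h.2.1 h.2.2, mul_add, Finset.sum_add_distrib]
  · simp [applyGate, h]

theorem applyGate_smul (g : GateMatrix) (a b : ℕ) (z : ℂ) (ψ : Qubits n) :
    applyGate g a b (z • ψ) = z • applyGate g a b ψ := by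
  by_cases h : a < n ∧ b < n ∧ a ≠ b
  · ext s
    simp only [PiLp.smul_apply, applyGate_apply g h.1 h.2.1 h.2.2, smul_eq_mul, Finset.mul_sum]
    exact Finset.sum_congr rfl fun p _ => by ring
  · simp [applyGate, h]

theorem applyGate_one (a b : ℕ) (ψ : Qubits n) : applyGate 1 a b ψ = ψ := by
  by_cases h : a < n ∧ b < n ∧ a ≠ b
  · ext s
    rw [applyGate_apply _ h.1 h.2.1 h.2.2, Finset.sum_eq_single (s ⟨a, h.1⟩, s ⟨b, h.2.1⟩)]
    · simp
    · intro p _ hp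
      rw [Matrix.one_apply_ne hp.symm, zero_mul]
    · simp
  · simp [applyGate, h]

theorem applyGate_mul (g h : GateMatrix) (a b : ℕ) (ψ : Qubits n) :
    applyGate g a b (applyGate h a b ψ) = applyGate (g * h) a b ψ := by
  by_cases hv : a < n ∧ b < n ∧ a ≠ b
  · obtain ⟨ha, hb, hab⟩ := hv
    have hab' : (⟨a, ha⟩ : Fin n) ≠ ⟨b, hb⟩ := by simpa using hab
    ext s
    simp only [applyGate_apply _ ha hb hab, Matrix.mul_apply, Finset.mul_sum, Finset.sum_mul,
      setPair_setPair, setPair_snd, setPair_fst hab', Prod.mk.eta]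
    rw [Finset.sum_comm]
    exact Finset.sum_congr rfl fun p _ => Finset.sum_congr rfl fun q _ => by ring
  · simp [applyGate, hv]

/-- Both sides are sums over a basis state and a bit pair. Exchanging the pair with the bits on the
two wires is an involution that turns one sum into the other, swapping row and column of the gate.
-/
theorem inner_applyGate (g : GateMatrix) (a b : ℕ) (ψ φ : Qubits n) :
    inner ℂ (applyGate g a b ψ) φ = inner ℂ ψ (applyGate g.conjTranspose a b φ) := by
  by_cases hv : a < n ∧ b < n ∧ a ≠ b
  swap
  · simp [applyGate, hv]
  obtain ⟨ha, hb, hab⟩ := hv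
  have hab' : (⟨a, ha⟩ : Fin n) ≠ ⟨b, hb⟩ := by simpa using hab
  simp only [PiLp.inner_apply, RCLike.inner_apply, applyGate_apply _ ha hb hab,
    map_sum, map_mul, Finset.mul_sum, Finset.sum_mul]
  rw [← Fintype.sum_prod_type', ← Fintype.sum_prod_type']
  let e : ((Fin n → Bool) × (Bool × Bool)) → ((Fin n → Bool) × (Bool × Bool)) := fun x =>
    (setPair ⟨a, ha⟩ ⟨b, hb⟩ x.2 x.1, (x.1 ⟨a, ha⟩, x.1 ⟨b, hb⟩))
  have he : Function.Involutive e := by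
    rintro ⟨s, p⟩
    simp [e, setPair_setPair, setPair_fst hab']
  rw [← Equiv.sum_comp (Function.Involutive.toPerm e he)]
  refine Finset.sum_congr rfl fun x _ => ?_
  simp only [Function.Involutive.coe_toPerm, e, setPair_setPair, setPair_snd, setPair_fst hab',
    Matrix.conjTranspose_apply, setPair_self, Prod.mk.eta, RCLike.star_def]
  ring

theorem norm_applyGate {g : GateMatrix} (hg : g ∈ Matrix.unitaryGroup (Bool × Bool) ℂ) (a b : ℕ)
    (ψ : Qubits n) : ‖applyGate g a b ψ‖ = ‖ψ‖ := by
  have h : inner ℂ (applyGate g a b ψ) (applyGate g a b ψ) = inner ℂ ψ ψ := by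
    rw [inner_applyGate, applyGate_mul, ← Matrix.star_eq_conjTranspose,
      Matrix.mem_unitaryGroup_iff'.1 hg, applyGate_one]
  rw [inner_self_eq_norm_sq_to_K, inner_self_eq_norm_sq_to_K] at h
  have h2 : ‖applyGate g a b ψ‖ ^ 2 = ‖ψ‖ ^ 2 := by exact_mod_cast h
  exact (sq_eq_sq₀ (norm_nonneg _) (norm_nonneg _)).1 h2

variable {G : Set GateMatrix}

theorem runCircuit_append (C D : List (G × ℕ × ℕ)) (ψ : Qubits n) :
    runCircuit (C ++ D) ψ = runCircuit D (runCircuit C ψ) := by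
  induction C generalizing ψ with
  | nil => rfl
  | cons x C ih => exact ih _

theorem runCircuit_add (C : List (G × ℕ × ℕ)) (ψ φ : Qubits n) :
    runCircuit C (ψ + φ) = runCircuit C ψ + runCircuit C φ := by
  induction C generalizing ψ φ with
  | nil => rfl
  | cons x C ih => simp only [runCircuit, applyGate_add, ih]

theorem runCircuit_smul (C : List (G × ℕ × ℕ)) (z : ℂ) (ψ : Qubits n) :
    runCircuit C (z • ψ) = z • runCircuit C ψ := by
  induction C generalizing ψ with
  | nil => rfl
  | cons x C ih => simp only [runCircuit, applyGate_smul, ih]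

theorem norm_runCircuit (hG : IsGateSet G) (C : List (G × ℕ × ℕ)) (ψ : Qubits n) :
    ‖runCircuit C ψ‖ = ‖ψ‖ := by
  induction C generalizing ψ with
  | nil => rfl
  | cons x C ih => rw [runCircuit, ih, norm_applyGate (hG.unitary _ x.1.2)]

/-- The inverse of a gate. -/
def gateInv (hG : IsGateSet G) (g : G) : G := ⟨_, hG.inv_mem g g.2⟩

/-- The inverse circuit. -/
def circuitInv (hG : IsGateSet G) (C : List (G × ℕ × ℕ)) : List (G × ℕ × ℕ) :=
  C.reverse.map (mapOp (gateInv hG))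

theorem runCircuit_circuitInv (hG : IsGateSet G) (C : List (G × ℕ × ℕ)) (ψ : Qubits n) :
    runCircuit (circuitInv hG C) (runCircuit C ψ) = ψ := by
  induction C generalizing ψ with
  | nil => rfl
  | cons x C ih =>
    have : circuitInv hG (x :: C) = circuitInv hG C ++ [mapOp (gateInv hG) x] := by
      simp [circuitInv]
    obtain ⟨g, a, b⟩ := x
    rw [this, runCircuit_append, runCircuit.eq_2 _ g a b C, ih]
    simp only [runCircuit, mapOp, gateInv, applyGate_mul]
    rw [← Matrix.star_eq_conjTranspose, Matrix.mem_unitaryGroup_iff'.1 (hG.unitary _ g.2),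
      applyGate_one]

/-- A circuit as an isometry. -/
def circuitIsometry (hG : IsGateSet G) (n : ℕ) (C : List (G × ℕ × ℕ)) :
    Qubits n →ₗᵢ[ℂ] Qubits n where
  toFun := runCircuit C
  map_add' := runCircuit_add C
  map_smul' := runCircuit_smul C
  norm_map' := norm_runCircuit hG C

end Circuits

/-! ### Additional wires -/

section Embedding

variable {n : ℕ}

/-- The basis state with the bits `s` followed by the bits `d`. -/
def extendBits (N : ℕ) (d : ℕ → Bool) (s : Fin n → Bool) : Fin N → Bool :=
  fun i => if h : (i : ℕ) < n then s ⟨i, h⟩ else d i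

theorem readWire_extendBits {N : ℕ} (hN : n ≤ N) (d : ℕ → Bool) (s : Fin n → Bool) {i : ℕ}
    (hi : i < n) : readWire (extendBits N d s) i = s ⟨i, hi⟩ := by
  simp [readWire, extendBits, hi, hi.trans_le hN]

theorem extendBits_injective {N : ℕ} (hN : n ≤ N) (d : ℕ → Bool) :
    Function.Injective (extendBits (n := n) N d) := fun s s' h => by
  funext i
  rw [← readWire_extendBits hN d s i.2, h, readWire_extendBits hN]

/-- `ψ ⊗ |d⟩` on `N` wires. -/
def embedPat (N : ℕ) (d : ℕ → Bool) (ψ : Qubits n) : Qubits N :=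
  WithLp.toLp 2 fun s =>
    if s = extendBits N d (fun i : Fin n => readWire s i) then ψ (fun i => readWire s i) else 0

theorem embedPat_extendBits {N : ℕ} (hN : n ≤ N) (d : ℕ → Bool) (ψ : Qubits n)
    (s : Fin n → Bool) : embedPat N d ψ (extendBits N d s) = ψ s := by
  have : (fun i : Fin n => readWire (extendBits N d s) i) = s :=
    funext fun i => readWire_extendBits hN d s i.2
  simp [embedPat, this]

theorem embedPat_of_notMem {N : ℕ} (d : ℕ → Bool) (ψ : Qubits n) {s : Fin N → Bool}
    (h : ∀ s₀ : Fin n → Bool, s ≠ extendBits N d s₀) : embedPat N d ψ s = 0 := by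
  simp [embedPat, h]

theorem eq_embedPat {N : ℕ} (hN : n ≤ N) {d : ℕ → Bool} {ψ : Qubits n} {φ : Qubits N}
    (h : ∀ s, φ (extendBits N d s) = ψ s)
    (h' : ∀ s, (∀ s₀ : Fin n → Bool, s ≠ extendBits N d s₀) → φ s = 0) : φ = embedPat N d ψ := by
  ext s
  by_cases hs : ∃ s₀ : Fin n → Bool, s = extendBits N d s₀
  · obtain ⟨s₀, rfl⟩ := hs
    rw [h, embedPat_extendBits hN]
  · rw [not_exists] at hs
    rw [h' s hs, embedPat_of_notMem d ψ hs]

theorem norm_sq_eq_sum (ψ : Qubits n) : ‖ψ‖ ^ 2 = ∑ s, ‖ψ s‖ ^ 2 := EuclideanSpace.norm_sq_eq ψ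

theorem norm_embedPat {N : ℕ} (hN : n ≤ N) (d : ℕ → Bool) (ψ : Qubits n) :
    ‖embedPat N d ψ‖ = ‖ψ‖ := by
  rw [← sq_eq_sq₀ (norm_nonneg _) (norm_nonneg _), norm_sq_eq_sum, norm_sq_eq_sum]
  refine (Fintype.sum_of_injective (extendBits N d) (extendBits_injective hN d) _ _ ?_ ?_).symm
  · intro s hs
    rw [embedPat_of_notMem d ψ fun s₀ h => hs ⟨s₀, h.symm⟩]
    simp
  · intro s
    rw [embedPat_extendBits hN]

theorem setPair_extendBits {N : ℕ} (hN : n ≤ N) (d : ℕ → Bool) {a b : ℕ} (ha : a < n) (hb : b < n)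
    (p : Bool × Bool) (s : Fin n → Bool) :
    setPair ⟨a, ha.trans_le hN⟩ ⟨b, hb.trans_le hN⟩ p (extendBits N d s) =
      extendBits N d (setPair ⟨a, ha⟩ ⟨b, hb⟩ p s) := by
  funext i
  by_cases hi : (i : ℕ) < n
  · simp [setPair, extendBits, Function.update_apply, hi, Fin.ext_iff]
  · have h1 : (i : ℕ) ≠ a := by omega
    have h2 : (i : ℕ) ≠ b := by omega
    simp [setPair, extendBits, hi, Fin.ext_iff, h1, h2]

theorem applyGate_embedPat {N : ℕ} (hN : n ≤ N) (d : ℕ → Bool) (g : GateMatrix) {a b : ℕ}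
    (ha : a < n) (hb : b < n) (hab : a ≠ b) (ψ : Qubits n) :
    applyGate g a b (embedPat N d ψ) = embedPat N d (applyGate g a b ψ) := by
  have hab' : (⟨a, ha.trans_le hN⟩ : Fin N) ≠ ⟨b, hb.trans_le hN⟩ := by simpa using hab
  refine eq_embedPat hN (fun s => ?_) (fun s hs => ?_)
  · rw [applyGate_apply g (ha.trans_le hN) (hb.trans_le hN) hab, applyGate_apply g ha hb hab]
    simp only [setPair_extendBits hN d ha hb, embedPat_extendBits hN]
    simp [extendBits, ha, hb]
  · rw [applyGate_apply g (ha.trans_le hN) (hb.trans_le hN) hab]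
    refine Finset.sum_eq_zero fun p _ => ?_
    rw [embedPat_of_notMem, mul_zero]
    -- If overwriting two of the first `n` bits gave a string with pattern `d`, writing the old bits
    -- back would give such a string too, namely `s`.
    intro s₀ h
    have h2 := congrArg (setPair ⟨a, ha.trans_le hN⟩ ⟨b, hb.trans_le hN⟩
      (s ⟨a, ha.trans_le hN⟩, s ⟨b, hb.trans_le hN⟩)) h
    rw [setPair_setPair, setPair_self, setPair_extendBits hN d ha hb] at h2
    exact hs _ h2

theorem runCircuit_embedPat {G : Set GateMatrix} {N : ℕ} (hN : n ≤ N) (d : ℕ → Bool)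
    {C : List (G × ℕ × ℕ)} (hC : ∀ op ∈ C, op.2.1 < n ∧ op.2.2 < n ∧ op.2.1 ≠ op.2.2)
    (ψ : Qubits n) : runCircuit C (embedPat N d ψ) = embedPat N d (runCircuit C ψ) := by
  induction C generalizing ψ with
  | nil => rfl
  | cons x C ih =>
    obtain ⟨h1, h2, h3⟩ := hC x (by simp)
    rw [runCircuit, runCircuit, applyGate_embedPat hN d _ h1 h2 h3,
      ih fun op hop => hC op (List.mem_cons_of_mem _ hop)]

theorem proj_embedPat {N : ℕ} (hN : n ≤ N) (d : ℕ → Bool) (S : (Fin N → Bool) → Prop)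
    [DecidablePred S] (S' : (Fin n → Bool) → Prop) [DecidablePred S']
    (h : ∀ s, S (extendBits N d s) ↔ S' s) (ψ : Qubits n) :
    proj S (embedPat N d ψ) = embedPat N d (proj S' ψ) := by
  refine eq_embedPat hN (fun s => ?_) (fun s hs => ?_)
  · simp [proj, h, embedPat_extendBits hN]
  · simp [proj, embedPat_of_notMem d ψ hs]

theorem embedPat_embedPat {n' N : ℕ} (hn : n ≤ n') (hN : n' ≤ N) (d : ℕ → Bool) (ψ : Qubits n) :
    embedPat N d (embedPat n' d ψ) = embedPat N d ψ := by
  have key : ∀ s : Fin n → Bool, extendBits N d s = extendBits N d (extendBits n' d s) := by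
    intro s
    funext i
    simp only [extendBits]
    split_ifs <;> first | rfl | omega
  refine eq_embedPat (hn.trans hN) (fun s => ?_) (fun s hs => ?_)
  · rw [key, embedPat_extendBits hN, embedPat_extendBits hn]
  · by_cases hs' : ∃ s₁ : Fin n' → Bool, s = extendBits N d s₁
    · obtain ⟨s₁, rfl⟩ := hs'
      rw [embedPat_extendBits hN, embedPat_of_notMem]
      rintro s₀ rfl
      exact hs s₀ (key s₀).symm
    · rw [not_exists] at hs'
      rw [embedPat_of_notMem d _ hs']

theorem padZeros_eq_embedPat (m : ℕ) (ψ : Qubits n) :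
    padZeros m ψ = embedPat (n + m) (fun _ => false) ψ := by
  refine eq_embedPat (Nat.le_add_right n m) (fun s => ?_) (fun s hs => ?_)
  · simp [padZeros, extendBits]
  · simp only [padZeros]
    rw [if_neg]
    intro h
    refine hs (fun i => s (Fin.castAdd m i)) (funext fun i => ?_)
    refine Fin.addCases (fun i => ?_) (fun i => ?_) i
    · simp [extendBits]
    · simp [extendBits, h]

theorem inputKet_eq_embedPat {k N : ℕ} (hk : k ≤ n) (hN : n ≤ N) (c : Fin k → Bool) :
    inputKet N c = embedPat N (fun _ => false) (inputKet n c) := by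
  have h : ∀ m, inputKet m c = EuclideanSpace.single (extendBits m (fun _ => false) c) 1 :=
    fun _ => rfl
  have key : extendBits N (fun _ => false) c =
      extendBits N (fun _ => false) (extendBits n (fun _ => false) c) := by
    funext i
    simp only [extendBits]
    split_ifs <;> first | rfl | omega
  rw [h, h]
  refine eq_embedPat hN (fun s => ?_) (fun s hs => ?_)
  · rw [key]
    simp [(extendBits_injective hN fun _ => false).eq_iff]
  · rw [key]
    simp [hs]

/-- Flipping padding bits before evaluation only changes the basis state of the padding. This
describes both oracle replies and recorded outcomes. -/
theorem embedPat_xor {N : ℕ} (hN : n ≤ N) (d m : ℕ → Bool) (hm : ∀ i < n, m i = false)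
    (ψ : Qubits n) (s : Fin N → Bool) :
    embedPat N d ψ (fun i => xor (s i) (m i)) = embedPat N (fun i => xor (d i) (m i)) ψ s := by
  have key : ∀ s₀ : Fin n → Bool, (fun i : Fin N => xor (extendBits N d s₀ i) (m i)) =
      extendBits N (fun i => xor (d i) (m i)) s₀ := by
    intro s₀
    funext i
    by_cases hi : (i : ℕ) < n <;> simp [extendBits, hi, hm]
  by_cases hs : ∃ s₀ : Fin n → Bool, (fun i => xor (s i) (m i)) = extendBits N d s₀
  · obtain ⟨s₀, h⟩ := hs
    have h2 : s = extendBits N (fun i => xor (d i) (m i)) s₀ := by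
      rw [← key, ← h]
      funext i
      simp
    rw [h, h2, embedPat_extendBits hN, embedPat_extendBits hN]
  · rw [not_exists] at hs
    rw [embedPat_of_notMem d ψ hs, embedPat_of_notMem]
    intro s₀ h
    refine hs s₀ ?_
    rw [h, ← key]
    funext i
    simp

end Embedding

/-! ### Measurements on wire `0` -/

section FirstWire

variable {n : ℕ}

/-- Projection onto the value `b` of wire `0`. -/
def projZero (b : Bool) (ψ : Qubits n) : Qubits n := proj (fun s => readWire s 0 = b) ψ

theorem projZero_add_projZero (ψ : Qubits n) : projZero false ψ + projZero true ψ = ψ := by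
  ext s
  simp only [projZero, proj, PiLp.add_apply]
  cases readWire s 0 <;> simp

theorem projZero_add (b : Bool) (ψ φ : Qubits n) :
    projZero b (ψ + φ) = projZero b ψ + projZero b φ := by
  ext s
  simp only [projZero, proj, PiLp.add_apply]
  split_ifs <;> simp

theorem norm_sq_projZero_add (ψ : Qubits n) :
    ‖projZero false ψ‖ ^ 2 + ‖projZero true ψ‖ ^ 2 = ‖ψ‖ ^ 2 := by
  simp only [norm_sq_eq_sum, ← Finset.sum_add_distrib]
  refine Finset.sum_congr rfl fun s _ => ?_
  simp only [projZero, proj]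
  cases readWire s 0 <;> simp

/-- The Pauli operator `Z` on wire `0`. -/
def pauliZ (ψ : Qubits n) : Qubits n := projZero false ψ - projZero true ψ

theorem pauliZ_add (ψ φ : Qubits n) : pauliZ (ψ + φ) = pauliZ ψ + pauliZ φ := by
  simp only [pauliZ, projZero_add]; abel

theorem pauliZ_apply (ψ : Qubits n) (s : Fin n → Bool) :
    pauliZ ψ s = (if readWire s 0 then -1 else 1) * ψ s := by
  simp only [pauliZ, projZero, proj, PiLp.sub_apply]
  cases readWire s 0 <;> simp

theorem norm_pauliZ (ψ : Qubits n) : ‖pauliZ ψ‖ = ‖ψ‖ := by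
  rw [← sq_eq_sq₀ (norm_nonneg _) (norm_nonneg _), norm_sq_eq_sum, norm_sq_eq_sum]
  refine Finset.sum_congr rfl fun s _ => ?_
  rw [pauliZ_apply]
  cases readWire s 0 <;> simp

theorem inner_pauliZ (ψ φ : Qubits n) : inner ℂ (pauliZ ψ) φ = inner ℂ ψ (pauliZ φ) := by
  simp only [PiLp.inner_apply, RCLike.inner_apply, pauliZ_apply]
  refine Finset.sum_congr rfl fun s _ => ?_
  cases readWire s 0 <;> simp

theorem re_inner_pauliZ (ψ : Qubits n) :
    (inner ℂ ψ (pauliZ ψ)).re = ‖projZero false ψ‖ ^ 2 - ‖projZero true ψ‖ ^ 2 := by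
  simp only [PiLp.inner_apply, RCLike.inner_apply, pauliZ_apply, Complex.re_sum, norm_sq_eq_sum,
    ← Finset.sum_sub_distrib]
  refine Finset.sum_congr rfl fun s _ => ?_
  simp only [projZero, proj]
  cases readWire s 0 <;> simp [Complex.sq_norm, Complex.normSq_apply]

theorem projZero_embedPat {N : ℕ} (h0 : 0 < n) (hN : n ≤ N) (d : ℕ → Bool) (b : Bool)
    (ψ : Qubits n) : projZero b (embedPat N d ψ) = embedPat N d (projZero b ψ) := by
  refine proj_embedPat hN d _ _ (fun s => ?_) ψ
  rw [readWire_extendBits hN d s h0]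
  simp [readWire, h0]

/-- With zero padding positivity of `n` is not needed: for `n = 0`, wire `0` is absent or a zero
ancilla, and `readWire` returns `false` either way. -/
theorem projZero_embedPat_false {N : ℕ} (hN : n ≤ N) (b : Bool) (ψ : Qubits n) :
    projZero b (embedPat N (fun _ => false) ψ) = embedPat N (fun _ => false) (projZero b ψ) := by
  refine proj_embedPat hN _ _ _ (fun s => ?_) ψ
  by_cases h0 : 0 < n
  · rw [readWire_extendBits hN _ s h0]
    simp [readWire, h0]
  · simp [readWire, extendBits, h0]

theorem applyGate_cnot {a b : ℕ} (ha : a < n) (hb : b < n) (hab : a ≠ b) (ψ : Qubits n)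
    (s : Fin n → Bool) : applyGate cnot a b ψ s =
      ψ (Function.update s ⟨b, hb⟩ (xor (s ⟨a, ha⟩) (s ⟨b, hb⟩))) := by
  rw [applyGate_apply _ ha hb hab,
    Finset.sum_eq_single (s ⟨a, ha⟩, xor (s ⟨a, ha⟩) (s ⟨b, hb⟩))]
  · simp [cnot, setPair]
  · rintro ⟨p, q⟩ _ hp
    have : ¬ ((s ⟨a, ha⟩, s ⟨b, hb⟩) = (p, xor p q)) := by
      rintro h
      obtain ⟨h1, h2⟩ := Prod.mk.inj h
      exact hp (by simp [h1, h2])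
    simp [cnot, this]
  · simp

/-- Copying wire `0` to the additional wire `n`. -/
theorem applyGate_cnot_zero_embedPat {N : ℕ} (h0 : 0 < n) (hN : n < N) (d : ℕ → Bool)
    (ψ : Qubits n) : applyGate cnot 0 n (embedPat N d ψ) = embedPat N d (projZero false ψ) +
      embedPat N (fun i => xor (d i) (decide (i = n))) (projZero true ψ) := by
  ext s
  rw [applyGate_cnot (h0.trans hN) hN h0.ne, ← projZero_embedPat h0 hN.le,
    ← projZero_embedPat h0 hN.le, PiLp.add_apply]
  have hr : readWire s 0 = s ⟨0, h0.trans hN⟩ := by simp [readWire, h0.trans hN]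
  simp only [projZero, proj, hr]
  cases h : s ⟨0, h0.trans hN⟩
  · simp
  · rw [← embedPat_xor hN.le d (fun i => decide (i = n)) (fun i hi => by simp [hi.ne])]
    simp only [Bool.true_eq_false, if_false, if_true, zero_add]
    refine congrArg (embedPat N d ψ).ofLp (funext fun i => ?_)
    by_cases hi : (i : ℕ) = n
    · obtain rfl : i = ⟨n, hN⟩ := Fin.ext hi
      simp
    · simp [hi, Fin.ext_iff]

/-- Adding the additional wire `n` to wire `0`. -/
theorem applyGate_cnot_embedPat_zero {N : ℕ} (h0 : 0 < n) (hN : n < N) (d : ℕ → Bool)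
    (ψ : Qubits n) : applyGate cnot n 0 (embedPat N d ψ) =
      embedPat N d (xorWires (fun _ : Fin 1 => d n) 0 ψ) := by
  -- On the embedded space the control carries the classical bit `d n`, so the gate acts on wire `0`
  -- alone.
  have key : ∀ s₀ : Fin n → Bool,
      Function.update (extendBits N d s₀) ⟨0, h0.trans hN⟩
        (xor (d n) (extendBits N d s₀ ⟨0, h0.trans hN⟩)) =
      extendBits N d (Function.update s₀ ⟨0, h0⟩ (xor (d n) (s₀ ⟨0, h0⟩))) := by
    intro s₀
    funext i
    by_cases hi : (i : ℕ) < n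
    · simp [extendBits, Function.update_apply, hi, h0, Fin.ext_iff]
    · have : (i : ℕ) ≠ 0 := by omega
      simp [extendBits, hi, Fin.ext_iff, this]
  refine eq_embedPat hN.le (fun s => ?_) (fun s hs => ?_)
  · rw [applyGate_cnot hN (h0.trans hN) h0.ne']
    have hn : extendBits N d s ⟨n, hN⟩ = d n := by simp [extendBits]
    rw [hn, key, embedPat_extendBits hN.le]
    refine congrArg ψ.ofLp (funext fun i => ?_)
    by_cases hi : (i : ℕ) = 0
    · obtain rfl : i = ⟨0, h0⟩ := Fin.ext hi
      simp [Bool.xor_comm]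
    · simp [hi, Fin.ext_iff]
  · rw [applyGate_cnot hN (h0.trans hN) h0.ne', embedPat_of_notMem]
    intro s₀ h
    have h1 : s ⟨n, hN⟩ = d n := by
      have := congrFun h ⟨n, hN⟩
      rw [Function.update_of_ne (by simp [Fin.ext_iff, h0.ne'])] at this
      simpa [extendBits] using this
    refine hs (Function.update s₀ ⟨0, h0⟩ (xor (d n) (s₀ ⟨0, h0⟩))) ?_
    rw [← key, ← h, h1]
    simp

theorem norm_xorWires {k : ℕ} (c : Fin k → Bool) (a : ℕ) (ψ : Qubits n) :
    ‖xorWires c a ψ‖ = ‖ψ‖ := by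
  rw [← sq_eq_sq₀ (norm_nonneg _) (norm_nonneg _), norm_sq_eq_sum, norm_sq_eq_sum]
  let e : (Fin n → Bool) → (Fin n → Bool) := fun s i =>
    xor (s i) (if h : a ≤ (i : ℕ) ∧ (i : ℕ) - a < k then c ⟨(i : ℕ) - a, h.2⟩ else false)
  have he : Function.Involutive e := fun s => by funext i; simp [e]
  exact Equiv.sum_comp (Function.Involutive.toPerm e he) fun s => ‖ψ s‖ ^ 2

theorem xorWires_false (ψ : Qubits n) : xorWires (fun _ : Fin 1 => false) 0 ψ = ψ := by
  ext s; simp [xorWires]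

theorem projZero_xorWires_true (h0 : 0 < n) (b : Bool) (ψ : Qubits n) :
    projZero b (xorWires (fun _ : Fin 1 => true) 0 ψ) =
      xorWires (fun _ : Fin 1 => true) 0 (projZero (!b) ψ) := by
  ext s
  simp only [projZero, proj, xorWires, readWire, h0, dif_pos]
  by_cases h : s ⟨0, h0⟩ = b <;> simp [h]

/-- An oracle reply written at or beyond `t` touches padding only, so the state stays a product of
`ψ` with a basis state, and padding below `t` survives. -/
theorem xorWires_embedPat {N k : ℕ} (hN : n ≤ N) (d : ℕ → Bool) {t : ℕ} (ht : n ≤ t)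
    (c : Fin k → Bool) (ψ : Qubits n) : ∃ d' : ℕ → Bool, (∀ i < t, d' i = d i) ∧
      xorWires c t (embedPat N d ψ) = embedPat N d' ψ := by
  refine ⟨fun i => xor (d i) (if h : t ≤ i ∧ i - t < k then c ⟨i - t, h.2⟩ else false),
    fun i hi => by simp [not_le.2 hi], ?_⟩
  ext s
  rw [← embedPat_xor hN d _ (fun i hi => by simp [not_le.2 (hi.trans_le ht)])]
  rfl

end FirstWire

/-! ### Oracle circuits -/

section Oracle

theorem PMF.sum_toReal {α : Type*} [Fintype α] (p : PMF α) : ∑ a, (p a).toReal = 1 := by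
  rw [← ENNReal.toReal_sum fun a _ => p.apply_ne_top a, ← tsum_fintype (L := .unconditional _),
    p.tsum_coe, ENNReal.toReal_one]

variable {n k : ℕ} {G : Set GateMatrix} (enc : Bool → PMF (Fin k → Bool))

theorem acceptProb_map_append (C : List (G × ℕ × ℕ)) (R : List (Option G × ℕ × ℕ))
    (ψ : Qubits n) :
    acceptProb enc (C.map (mapOp some) ++ R) ψ = acceptProb enc R (runCircuit C ψ) := by
  induction C generalizing ψ with
  | nil => rfl
  | cons x C ih => exact ih _

theorem acceptProb_map (C : List (G × ℕ × ℕ)) (ψ : Qubits n) :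
    acceptProb enc (C.map (mapOp some)) ψ = ‖projZero true (runCircuit C ψ)‖ ^ 2 := by
  have := acceptProb_map_append enc C [] ψ
  rwa [List.append_nil] at this

/-- Oracle calls on the first `l` wires whose answers are discarded measure these wires. -/
theorem acceptProb_sweep {w : ℕ} {l : ℕ} (hl : l ≤ w) :
    ∀ {R : List (Option G × ℕ × ℕ)} {F : Qubits w → ℝ},
    (∀ d : ℕ → Bool, d w = false → ∀ ψ, acceptProb enc R (embedPat (w + 2) d ψ) = F ψ) →
    ∀ d : ℕ → Bool, d w = false → ∀ ψ : Qubits w,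
      acceptProb enc (sweep none l w ++ R) (embedPat (w + 2) d ψ) =
      ∑ α : Fin l → Bool, F (proj (fun s => ∀ i : Fin l, readWire s i = α i) ψ) := by
  induction l with
  | zero =>
    intro R F hF d hd ψ
    simp [sweep, hF d hd, proj]
  | succ l ih =>
    intro R F hF d hd ψ
    have hs : sweep (none : Option G) (l + 1) w = sweep none l w ++ [(none, l, w + 1)] := by
      simp [sweep, List.range_succ]
    rw [hs, List.append_assoc, List.singleton_append,
      -- The last call is absorbed into the continuation, whose acceptance probability becomes the
      -- sum over the bit measured there. Quantifying over all `d` with `d w = false` lets wire `w +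
      -- 1` hold any garbage.
      ih (by omega) (F := fun ψ => ∑ x : Bool, F (proj (fun s => readWire s l = x) ψ)) ?_ d hd ψ]
    · rw [← Fintype.sum_prod_type_right']
      refine Fintype.sum_equiv (Fin.snocEquiv fun _ => Bool) _ _ ?_
      rintro ⟨x, α⟩
      congr 1
      ext s
      simp only [proj, Fin.forall_fin_succ', Fin.snocEquiv_apply, Fin.snoc_castSucc, Fin.snoc_last,
        Fin.val_castSucc, Fin.val_last]
      by_cases h1 : readWire s l = x <;> simp [h1]
    · intro d hd ψ
      rw [acceptProb]
      refine Finset.sum_congr rfl fun x _ => ?_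
      have hp : proj (fun s => readWire s l = x) (embedPat (w + 2) d ψ) =
          embedPat (w + 2) d (proj (fun s => readWire s l = x) ψ) := by
        refine proj_embedPat (by omega) d _ _ (fun s => ?_) ψ
        rw [readWire_extendBits (by omega) d s (by omega : l < w)]
        simp [readWire, show l < w by omega]
      rw [hp]
      -- The acceptance probability is the same for every reply `c`, so the encryption probabilities
      -- sum out to 1.
      have : ∀ c : Fin k → Bool, acceptProb enc R (xorWires c (w + 1) (embedPat (w + 2) d
          (proj (fun s => readWire s l = x) ψ))) = F (proj (fun s => readWire s l = x) ψ) := by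
        intro c
        obtain ⟨d', hd', h⟩ := xorWires_embedPat (by omega : w ≤ w + 2) d (Nat.le_succ w) c
          (proj (fun s => readWire s l = x) ψ)
        rw [h, hF d' ((hd' w (by omega)).trans hd)]
      simp only [this]
      rw [← Finset.sum_mul, PMF.sum_toReal, one_mul]

end Oracle

/-! ### Sequential measurements -/

section Sequential

variable {w : ℕ} {G : Set GateMatrix}

/-- Expectation of the observable `Z` on wire `0` after the circuit `C`. -/
def bias (C : List (G × ℕ × ℕ)) (ψ : Qubits w) : ℝ :=
  ‖projZero false (runCircuit C ψ)‖ ^ 2 - ‖projZero true (runCircuit C ψ)‖ ^ 2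

theorem bias_eq (hG : IsGateSet G) (C : List (G × ℕ × ℕ)) (ψ : Qubits w) :
    bias C ψ = ‖ψ‖ ^ 2 - 2 * ‖projZero true (runCircuit C ψ)‖ ^ 2 := by
  have h := norm_sq_projZero_add (runCircuit C ψ)
  rw [norm_runCircuit hG] at h
  rw [bias, ← h]
  ring

/-- The probability that the measurement implemented by `C₀` followed by the one implemented by
`C₁` gives different outcomes. -/
def parityProb (hG : IsGateSet G) (C₀ C₁ : List (G × ℕ × ℕ)) (ψ : Qubits w) : ℝ :=
  ‖projZero true (runCircuit (circuitInv hG C₀ ++ C₁) (projZero false (runCircuit C₀ ψ)))‖ ^ 2 +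
  ‖projZero false (runCircuit (circuitInv hG C₀ ++ C₁) (projZero true (runCircuit C₀ ψ)))‖ ^ 2

theorem norm_sq_real_combination (u v w : Qubits n) (α β γ : ℝ) :
    ‖(α : ℂ) • u + (β : ℂ) • v + (γ : ℂ) • w‖ ^ 2 =
      α ^ 2 * ‖u‖ ^ 2 + β ^ 2 * ‖v‖ ^ 2 + γ ^ 2 * ‖w‖ ^ 2 + 2 * α * β * (inner ℂ u v).re +
        2 * α * γ * (inner ℂ u w).re + 2 * β * γ * (inner ℂ v w).re := by
  rw [norm_add_sq (𝕜 := ℂ), norm_add_sq (𝕜 := ℂ)]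
  simp only [norm_smul, inner_add_left, inner_smul_left, inner_smul_right, mul_pow,
    Complex.norm_real, Real.norm_eq_abs, sq_abs, RCLike.re_to_complex, Complex.conj_ofReal,
    Complex.add_re, Complex.re_ofReal_mul]
  ring

/-- The Gram matrix of a vector and its images under two `±1`-valued observables is positive. -/
theorem bias_quadratic_form_nonneg (hG : IsGateSet G) (C₀ C₁ : List (G × ℕ × ℕ)) (ψ : Qubits w)
    (α β γ : ℝ) : 0 ≤ (α ^ 2 + β ^ 2 + γ ^ 2) * ‖ψ‖ ^ 2 + 2 * α * β * bias C₀ ψ +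
      2 * α * γ * bias C₁ ψ + 2 * β * γ * (‖ψ‖ ^ 2 - 2 * parityProb hG C₀ C₁ ψ) := by
  set ξ := runCircuit C₀ ψ with hξ
  let W := circuitIsometry hG w (circuitInv hG C₀ ++ C₁)
  have hWξ : W ξ = runCircuit C₁ ψ := by
    change runCircuit _ _ = _
    rw [runCircuit_append, hξ, runCircuit_circuitInv]
  have hnξ : ‖ξ‖ = ‖ψ‖ := norm_runCircuit hG _ _
  -- This vector is the image under `C₁` of `αψ + βB₀ψ + γB₁ψ`: the isometry `W` undoes `C₀` and
  -- then applies `C₁`.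
  have h := sq_nonneg ‖(α : ℂ) • W ξ + (β : ℂ) • W (pauliZ ξ) + (γ : ℂ) • pauliZ (W ξ)‖
  rw [norm_sq_real_combination, norm_pauliZ, W.norm_map, W.norm_map, norm_pauliZ, W.inner_map_map,
    re_inner_pauliZ, re_inner_pauliZ, hnξ] at h
  have hcross : (inner ℂ (W (pauliZ ξ)) (pauliZ (W ξ))).re =
      ‖ψ‖ ^ 2 - 2 * parityProb hG C₀ C₁ ψ := by
    set a := projZero false ξ with ha
    set b := projZero true ξ with hb
    have hab : ξ = a + b := (projZero_add_projZero ξ).symm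
    have hz : pauliZ ξ = a - b := rfl
    -- The interference terms between the two outcomes of the first measurement have equal real
    -- parts and enter with opposite signs. What survives is the correlation of the sequential
    -- outcomes.
    have h1 : (inner ℂ (W b) (pauliZ (W a))).re = (inner ℂ (W a) (pauliZ (W b))).re := by
      rw [← inner_pauliZ, ← inner_conj_symm, Complex.conj_re]
    have h2 := norm_sq_projZero_add (W a)
    have h3 := norm_sq_projZero_add (W b)
    have h4 := norm_sq_projZero_add ξ
    rw [← ha, ← hb, hnξ] at h4
    rw [W.norm_map] at h2 h3
    have hp : parityProb hG C₀ C₁ ψ = ‖projZero true (W a)‖ ^ 2 + ‖projZero false (W b)‖ ^ 2 := rfl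
    rw [hz, hab, map_sub, map_add, pauliZ_add, inner_sub_left, inner_add_right, inner_add_right,
      Complex.sub_re, Complex.add_re, Complex.add_re, h1, re_inner_pauliZ, re_inner_pauliZ, hp]
    linarith
  rw [hcross, hWξ] at h
  unfold bias
  linarith

/-- The circuit that outputs the parity of the outcomes of two measurements, the first of which
is recorded on wire `w`. -/
def parityCircuit (hG : IsGateSet G) (C₀ C₁ : List (G × ℕ × ℕ)) (w : ℕ) : List (G × ℕ × ℕ) :=
  C₀ ++ ([(⟨cnot, hG.cnot_mem⟩, 0, w)] ++ ((circuitInv hG C₀ ++ C₁) ++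
    [(⟨cnot, hG.cnot_mem⟩, w, 0)]))

theorem circuitInv_wires (hG : IsGateSet G) {C : List (G × ℕ × ℕ)} {n : ℕ}
    (hC : ∀ op ∈ C, op.2.1 < n ∧ op.2.2 < n ∧ op.2.1 ≠ op.2.2) :
    ∀ op ∈ circuitInv hG C, op.2.1 < n ∧ op.2.2 < n ∧ op.2.1 ≠ op.2.2 := by
  intro op hop
  simp only [circuitInv, List.mem_map, List.mem_reverse] at hop
  obtain ⟨x, hx, rfl⟩ := hop
  exact hC x hx

theorem norm_sq_add_of_disjoint {N : ℕ} {φ χ : Qubits N} (h : ∀ s, φ s = 0 ∨ χ s = 0) :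
    ‖φ + χ‖ ^ 2 = ‖φ‖ ^ 2 + ‖χ‖ ^ 2 := by
  simp only [norm_sq_eq_sum, ← Finset.sum_add_distrib]
  refine Finset.sum_congr rfl fun s _ => ?_
  rcases h s with h | h <;> simp [h]

theorem projZero_parityCircuit (hG : IsGateSet G) {C₀ C₁ : List (G × ℕ × ℕ)} (hw : 0 < w)
    (h₀ : ∀ op ∈ C₀, op.2.1 < w ∧ op.2.2 < w ∧ op.2.1 ≠ op.2.2)
    (h₁ : ∀ op ∈ C₁, op.2.1 < w ∧ op.2.2 < w ∧ op.2.1 ≠ op.2.2)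
    {d : ℕ → Bool} (hd : d w = false) (ψ : Qubits w) :
    ‖projZero true (runCircuit (parityCircuit hG C₀ C₁ w) (embedPat (w + 2) d ψ))‖ ^ 2 =
      parityProb hG C₀ C₁ ψ := by
  have hN : w ≤ w + 2 := by omega
  have hN' : w < w + 2 := by omega
  have hW : ∀ op ∈ circuitInv hG C₀ ++ C₁, op.2.1 < w ∧ op.2.2 < w ∧ op.2.1 ≠ op.2.2 := by
    intro op hop
    rcases List.mem_append.1 hop with hop | hop
    · exact circuitInv_wires hG h₀ op hop
    · exact h₁ op hop
  have hd' : xor (d w) (decide (w = w)) = true := by simp [hd]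
  rw [parityCircuit, runCircuit_append, runCircuit_append, runCircuit_append,
    runCircuit_embedPat hN d h₀]
  simp only [runCircuit]
  rw [applyGate_cnot_zero_embedPat hw hN', runCircuit_add, runCircuit_embedPat hN _ hW,
    -- On the branch where `true` is recorded, the final controlled-NOT flips wire `0`, so accepting
    -- means that the second outcome was `false`.
    runCircuit_embedPat hN _ hW, applyGate_add, applyGate_cnot_embedPat_zero hw hN',
    applyGate_cnot_embedPat_zero hw hN', hd', hd, xorWires_false, projZero_add,
    projZero_embedPat hw hN, projZero_embedPat hw hN, projZero_xorWires_true hw,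
    norm_sq_add_of_disjoint, norm_embedPat hN, norm_embedPat hN, norm_xorWires]
  · rfl
  -- The branches carry different bits on wire `w`; their supports are disjoint and their
  -- probabilities add.
  · intro s
    by_cases hs : s ⟨w, hN'⟩ = false
    · right
      refine embedPat_of_notMem _ _ ?_
      rintro s₀ rfl
      simp [extendBits, hd] at hs
    · left
      refine embedPat_of_notMem _ _ ?_
      rintro s₀ rfl
      simp [extendBits, hd] at hs

end Sequential

/-! ### Averages over keys, questions and answers -/

section Average

variable (E : EncryptionScheme) (lam : ℕ)

/-- The average of a quantity that depends on the decrypted answer, the encrypted question and the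
encrypted answer. Encrypted answers are summed over, not averaged. -/
def average (x : Bool)
    (F : Bool → (Fin (E.ctLen lam) → Bool) → (Fin (E.ansLen lam) → Bool) → ℝ) : ℝ :=
  ∑ ω : (Fin (E.keyLen lam) → Bool) × (Fin (E.ctLen lam) → Bool) × (Fin (E.ansLen lam) → Bool) ×
    Bool, ((E.Gen lam ω.1).toReal * (E.Enc lam ω.1 x ω.2.1).toReal *
      (E.Dec lam ω.1 ω.2.2.1 ω.2.2.2).toReal) * F ω.2.2.2 ω.2.1 ω.2.2.1

variable {E lam} {x : Bool}
  {F F' : Bool → (Fin (E.ctLen lam) → Bool) → (Fin (E.ansLen lam) → Bool) → ℝ}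

theorem average_add : average E lam x (fun a χ α => F a χ α + F' a χ α) =
    average E lam x F + average E lam x F' := by
  simp only [average, mul_add, Finset.sum_add_distrib]

theorem average_const_mul (r : ℝ) : average E lam x (fun a χ α => r * F a χ α) =
    r * average E lam x F := by
  simp only [average, Finset.mul_sum]
  exact Finset.sum_congr rfl fun _ _ => by ring

theorem average_nonneg (h : ∀ a χ α, 0 ≤ F a χ α) : 0 ≤ average E lam x F :=
  Finset.sum_nonneg fun _ _ => mul_nonneg (by positivity) (h _ _ _)

theorem average_eq_nested : average E lam x F = ∑ sk, (E.Gen lam sk).toReal *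
    ∑ χ, (E.Enc lam sk x χ).toReal * ∑ α, ∑ a, (E.Dec lam sk α a).toReal * F a χ α := by
  simp only [average, Fintype.sum_prod_type, Finset.mul_sum, mul_assoc]

theorem average_eq_of_indep
    {H : (Fin (E.ctLen lam) → Bool) → (Fin (E.ansLen lam) → Bool) → ℝ} :
    average E lam x (fun _ => H) = ∑ sk, (E.Gen lam sk).toReal *
      ∑ χ, (E.Enc lam sk x χ).toReal * ∑ α, H χ α := by
  simp only [average_eq_nested, ← Finset.sum_mul, PMF.sum_toReal, one_mul]

theorem average_eq_one {H : (Fin (E.ctLen lam) → Bool) → (Fin (E.ansLen lam) → Bool) → ℝ}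
    (h : ∀ χ, ∑ α, H χ α = 1) : average E lam x (fun _ => H) = 1 := by
  simp only [average_eq_of_indep, h, mul_one, PMF.sum_toReal]

theorem compiledProb_eq_average (M : CompiledModel (E.ctLen lam) (E.ansLen lam)) (a b x y : Bool) :
    compiledProb E lam M a b x y = average E lam x fun a' χ α =>
      if a' = a then (inner ℂ (M.state χ α) (M.N y b (M.state χ α))).re else 0 := by
  simp [average_eq_nested, compiledProb]

end Average

/-! ### The sum-of-squares bound -/

/-- The sum of `h₀` and `τ²` times `h₁`. `G₀`, `G₁` are the averaged correlators of the two
observables and `m₀`, `m₁` their averaged marginal sums; the last two terms of the bound vanish when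
these do not depend on the question. -/
theorem tilted_sum_of_squares {S C s c τ q₀ q₁ E₀₀ E₀₁ E₁₀ E₁₁ m₀ m₁ G₀ G₁ : ℝ} (hS : S ≠ 0)
    (hC : C ≠ 0) (hSC : S ^ 2 + C ^ 2 = 1) (hsc : s ^ 2 + c ^ 2 = 1) (hτ0 : τ ≠ 0)
    (hτ : 1 / τ ^ 2 = s ^ 2 / (S / C) ^ 2 - c ^ 2) (hq : q₀ + q₁ = 1)
    (h₀ : 0 ≤ 1 + 1 / (2 * C ^ 2) - 1 / C * (E₀₀ + E₀₁) + 1 / (2 * C ^ 2) * G₀)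
    (h₁ : 0 ≤ 1 + (s ^ 2 / (2 * S ^ 2) + c ^ 2 / (2 * C ^ 2)) - s / S * (E₁₀ - E₁₁) - c / C * m₁ +
      (c ^ 2 / (2 * C ^ 2) - s ^ 2 / (2 * S ^ 2)) * G₁) :
    1 / C * (E₀₀ + E₀₁) + τ ^ 2 * (s / S) * (E₁₀ - E₁₁) +
      τ ^ 2 * (c / C) * (q₀ * m₀ + q₁ * m₁) ≤
      2 * (1 + τ ^ 2) + 1 / (2 * C ^ 2) * (G₀ - G₁) + τ ^ 2 * (c / C) * (q₀ * (m₀ - m₁)) := by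
  obtain rfl : q₁ = 1 - q₀ := by linarith
  have k1 : S ^ 2 * (1 + τ ^ 2 * c ^ 2) = τ ^ 2 * s ^ 2 * C ^ 2 := by
    field_simp at hτ
    linarith
  -- By the Pythagorean identities the relation on τ becomes `S²(1 + τ²) = τ²s²`. With `k3`, the
  -- constants beyond `1 + τ²` then sum to twice this value, another `1 + τ²`.
  have k2 : τ ^ 2 * (s ^ 2 / (2 * S ^ 2)) = (1 + τ ^ 2) / 2 := by
    rw [← mul_div_assoc, div_eq_div_iff (by positivity) (by norm_num)]
    have : C ^ 2 = 1 - S ^ 2 := by linarith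
    rw [this] at k1
    have h2 : c ^ 2 = 1 - s ^ 2 := by linarith
    rw [h2] at k1
    linarith
  have k3 : 1 / (2 * C ^ 2) + τ ^ 2 * (c ^ 2 / (2 * C ^ 2)) = τ ^ 2 * (s ^ 2 / (2 * S ^ 2)) := by
    field_simp
    linarith
  have h2 := mul_nonneg (sq_nonneg τ) h₁
  -- This is `k3` again: the correlator coefficients of the two squares are opposite.
  have k4 : 1 / (2 * C ^ 2) * G₀ + τ ^ 2 * ((c ^ 2 / (2 * C ^ 2) - s ^ 2 / (2 * S ^ 2)) * G₁) =
      1 / (2 * C ^ 2) * (G₀ - G₁) := by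
    have : τ ^ 2 * (c ^ 2 / (2 * C ^ 2) - s ^ 2 / (2 * S ^ 2)) = - (1 / (2 * C ^ 2)) := by
      linarith
    rw [← mul_assoc, this]
    ring
  nlinarith

/-! ### Closure properties of negligible functions -/

theorem Negligible.add {f g : ℕ → ℝ} (hf : Negligible f) (hg : Negligible g) :
    Negligible fun n => f n + g n := by
  intro k
  obtain ⟨N, hN⟩ := hf (k + 1)
  obtain ⟨N', hN'⟩ := hg (k + 1)
  refine ⟨max (max N N') 2, fun n hn => ?_⟩
  have h2 : (2 : ℝ) ≤ n := by exact_mod_cast (le_max_right _ _).trans hn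
  have h1 := hN n (by omega)
  have h1' := hN' n (by omega)
  have hk : (0 : ℝ) < (n : ℝ) ^ k := by positivity
  -- One spare power of `n ≥ 2` absorbs the factor 2.
  calc f n + g n ≤ 1 / (n : ℝ) ^ (k + 1) + 1 / (n : ℝ) ^ (k + 1) := add_le_add h1 h1'
    _ ≤ 1 / (n : ℝ) ^ k := by
      rw [← add_div, div_le_div_iff₀ (by positivity) hk, pow_succ]
      nlinarith

theorem Negligible.const_mul {f : ℕ → ℝ} (hf : Negligible f) {r : ℝ} (hr : 0 ≤ r) :
    Negligible fun n => r * f n := by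
  intro k
  obtain ⟨N, hN⟩ := hf (k + 1)
  obtain ⟨R, hR⟩ := exists_nat_ge r
  refine ⟨max (max N R) 1, fun n hn => ?_⟩
  have hn1 : (1 : ℝ) ≤ n := by exact_mod_cast (le_max_right _ _).trans hn
  have hnR : (R : ℝ) ≤ n := by
    exact_mod_cast ((le_max_right N R).trans (le_max_left _ 1)).trans hn
  have hk : (0 : ℝ) < (n : ℝ) ^ k := by positivity
  calc r * f n ≤ r * (1 / (n : ℝ) ^ (k + 1)) := mul_le_mul_of_nonneg_left (hN n (by omega)) hr
    _ ≤ 1 / (n : ℝ) ^ k := by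
      rw [mul_one_div, div_le_div_iff₀ (by positivity) hk, pow_succ, one_mul, mul_comm _ (n : ℝ)]
      exact mul_le_mul_of_nonneg_right (hR.trans hnR) hk.le

/-! ### Compiled models -/

theorem norm_inputKet {n k : ℕ} (c : Fin k → Bool) : ‖inputKet n c‖ = 1 := by
  simp [inputKet]

theorem sum_norm_sq_proj {n l : ℕ} (ψ : Qubits n) :
    ∑ α : Fin l → Bool, ‖proj (fun s => ∀ i : Fin l, readWire s i = α i) ψ‖ ^ 2 = ‖ψ‖ ^ 2 := by
  simp only [norm_sq_eq_sum]
  rw [Finset.sum_comm]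
  refine Finset.sum_congr rfl fun s _ => ?_
  rw [Finset.sum_eq_single fun i : Fin l => readWire s i]
  · simp [proj]
  · intro α _ hα
    have : ¬ ∀ i : Fin l, readWire s i = α i := fun h => hα (funext fun i => (h i).symm)
    simp [proj, this]
  · simp

theorem acceptProb_measured {G : Set GateMatrix} {n k l w : ℕ} (enc : Bool → PMF (Fin k → Bool))
    (hk : k ≤ n) (hl : l ≤ n) (hw : n ≤ w) {C : List (G × ℕ × ℕ)}
    (hC : ∀ op ∈ C, op.2.1 < n ∧ op.2.2 < n ∧ op.2.1 ≠ op.2.2)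
    {R : List (Option G × ℕ × ℕ)} {F : Qubits w → ℝ}
    (hF : ∀ d : ℕ → Bool, d w = false → ∀ ψ, acceptProb enc R (embedPat (w + 2) d ψ) = F ψ)
    (χ : Fin k → Bool) :
    acceptProb enc (C.map (mapOp some) ++ (sweep none l w ++ R)) (inputKet (w + 2) χ) =
      ∑ α : Fin l → Bool, F (embedPat w (fun _ => false)
        (proj (fun s => ∀ i : Fin l, readWire s i = α i) (runCircuit C (inputKet n χ)))) := by
  rw [acceptProb_map_append, inputKet_eq_embedPat hk (by omega : n ≤ w + 2),
    runCircuit_embedPat (by omega) _ hC, ← embedPat_embedPat hw (by omega : w ≤ w + 2),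
    acceptProb_sweep enc (hl.trans hw) hF _ rfl]
  refine Finset.sum_congr rfl fun α _ => congrArg F ?_
  refine proj_embedPat hw _ _ _ (fun s => ?_) _
  refine forall_congr' fun i => ?_
  rw [readWire_extendBits hw _ s (by omega : (i : ℕ) < n)]
  simp [readWire, show (i : ℕ) < n by omega]

/-- An adversary that prepares the first-round state, measures the encrypted answer and continues
with `D`. -/
def secondRoundAdversary {G : Set GateMatrix} (C : List (G × ℕ × ℕ)) (l w : ℕ)
    (D : List (G × ℕ × ℕ)) : List (Option G × ℕ × ℕ) :=
  C.map (mapOp some) ++ (sweep none l w ++ D.map (mapOp some))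

theorem secondRoundAdversary_wires {G : Set GateMatrix} {C D : List (G × ℕ × ℕ)} {l w : ℕ}
    (hl : l ≤ w) (hC : ∀ op ∈ C, op.2.1 < w ∧ op.2.2 < w ∧ op.2.1 ≠ op.2.2)
    (hD : ∀ op ∈ D, op.2.1 < w + 2 ∧ op.2.2 < w + 2 ∧ op.2.1 ≠ op.2.2) :
    ∀ op ∈ secondRoundAdversary C l w D,
      op.2.1 < w + 2 ∧ op.2.2 < w + 2 ∧ op.2.1 ≠ op.2.2 := by
  intro op hop
  simp only [secondRoundAdversary, sweep, List.mem_append, List.mem_map, List.mem_range] at hop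
  rcases hop with ⟨x, hx, rfl⟩ | ⟨i, hi, rfl⟩ | ⟨x, hx, rfl⟩
  · obtain ⟨h1, h2, h3⟩ := hC x hx
    exact ⟨by simp only [mapOp]; omega, by simp only [mapOp]; omega, h3⟩
  · exact ⟨by dsimp only; omega, by dsimp only; omega, by dsimp only; omega⟩
  · exact hD x hx

theorem parityCircuit_wires {G : Set GateMatrix} (hG : IsGateSet G) {C₀ C₁ : List (G × ℕ × ℕ)}
    {w : ℕ} (hw : 0 < w) (h₀ : ∀ op ∈ C₀, op.2.1 < w ∧ op.2.2 < w ∧ op.2.1 ≠ op.2.2)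
    (h₁ : ∀ op ∈ C₁, op.2.1 < w ∧ op.2.2 < w ∧ op.2.1 ≠ op.2.2) :
    ∀ op ∈ parityCircuit hG C₀ C₁ w, op.2.1 < w + 2 ∧ op.2.2 < w + 2 ∧ op.2.1 ≠ op.2.2 := by
  have key : ∀ C : List (G × ℕ × ℕ), (∀ op ∈ C, op.2.1 < w ∧ op.2.2 < w ∧ op.2.1 ≠ op.2.2) →
      ∀ op ∈ C, op.2.1 < w + 2 ∧ op.2.2 < w + 2 ∧ op.2.1 ≠ op.2.2 := fun C hC op hop => by
    obtain ⟨a, b, c⟩ := hC op hop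
    exact ⟨by omega, by omega, c⟩
  intro op hop
  simp only [parityCircuit, List.mem_append, List.mem_singleton] at hop
  rcases hop with hop | rfl | (hop | hop) | rfl
  · exact key _ h₀ op hop
  · exact ⟨by dsimp only; omega, by dsimp only; omega, by dsimp only; omega⟩
  · exact key _ (circuitInv_wires hG h₀) op hop
  · exact key _ h₁ op hop
  · exact ⟨by dsimp only; omega, by dsimp only; omega, by dsimp only; omega⟩

theorem Emits.secondRoundAdversary {G : Set GateMatrix} {w n r : ℕ → ℕ}
    {C D : ℕ → List (G × ℕ × ℕ)} (hC : LogspaceUniform n r C)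
    (hD : Emits w fun lam => (D lam).map (mapOp (some : G → Option G))) :
    Emits w fun lam => secondRoundAdversary (C lam) (r lam) (w lam) (D lam) :=
  (hC.emits w some).append ((hC.emits_sweep w some none).append hD)

theorem Emits.parityCircuit {G : Set GateMatrix} (hG : IsGateSet G) {w n₀ n₁ r₀ r₁ : ℕ → ℕ}
    {C₀ C₁ : ℕ → List (G × ℕ × ℕ)} (h₀ : LogspaceUniform n₀ r₀ C₀)
    (h₁ : LogspaceUniform n₁ r₁ C₁) :
    Emits w fun lam => (parityCircuit hG (C₀ lam) (C₁ lam) (w lam)).map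
      (mapOp (some : G → Option G)) := by
  have h := (h₀.emits w (some : G → Option G)).append <|
    (Emits.op_fst w (some ⟨cnot, hG.cnot_mem⟩ : Option G)).append <|
    ((h₀.emits_reverse w (fun g => (some (gateInv hG g) : Option G))).append
      (h₁.emits w (some : G → Option G))).append
    (Emits.fst_op w (some ⟨cnot, hG.cnot_mem⟩ : Option G))
  have e : ∀ l : List (G × ℕ × ℕ), (l.map (mapOp (gateInv hG))).map
      (mapOp (some : G → Option G)) = l.map (mapOp fun g => (some (gateInv hG g) : Option G)) := by
    intro l
    rw [List.map_map]
    rfl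
  simp only [_root_.parityCircuit, circuitInv, List.map_append, e]
  exact h

theorem adversaryProb_eq_average {G : Set GateMatrix} {E : EncryptionScheme} {lam n w : ℕ}
    (hk : E.ctLen lam ≤ n) (hl : E.ansLen lam ≤ n) (hw : n ≤ w) {C D : List (G × ℕ × ℕ)}
    (hC : ∀ op ∈ C, op.2.1 < n ∧ op.2.2 < n ∧ op.2.1 ≠ op.2.2) {F : Qubits w → ℝ}
    (hF : ∀ d : ℕ → Bool, d w = false → ∀ ψ,
      ‖projZero true (runCircuit D (embedPat (w + 2) d ψ))‖ ^ 2 = F ψ) (x : Bool) :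
    E.adversaryProb lam (w + 2) (secondRoundAdversary C (E.ansLen lam) w D) x =
      average E lam x fun _ χ α => F (embedPat w (fun _ => false)
        (proj (fun s => ∀ i : Fin (E.ansLen lam), readWire s i = α i)
          (runCircuit C (inputKet n χ)))) := by
  rw [average_eq_of_indep, EncryptionScheme.adversaryProb]
  refine Finset.sum_congr rfl fun sk _ => ?_
  congr 1
  refine Finset.sum_congr rfl fun χ _ => ?_
  congr 1
  exact acceptProb_measured _ hk hl hw hC (fun d hd ψ => by rw [acceptProb_map, hF d hd]) χ

theorem mul_self_boolSign (a : Bool) : boolSign a * boolSign a = 1 := by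
  cases a <;> simp [boolSign]

/-- The bound on a compiled functional whose measurements are observables after the circuits `C₀`
and `C₁`, in terms of the dependence of the second-round statistics on the question. -/
theorem compiledValue_tilted_le {G : Set GateMatrix} (hG : IsGateSet G) {θ φ τ : ℝ} (q : PMF Bool)
    (hS : Real.sin φ ≠ 0) (hC : Real.cos φ ≠ 0) (hτ0 : τ ≠ 0)
    (hτ : 1 / τ ^ 2 = Real.sin (2 * θ) ^ 2 / Real.tan φ ^ 2 - Real.cos (2 * θ) ^ 2)
    {E : EncryptionScheme} {lam w : ℕ} (M : CompiledModel (E.ctLen lam) (E.ansLen lam))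
    (C₀ C₁ : List (G × ℕ × ℕ))
    (Φ : (Fin (E.ctLen lam) → Bool) → (Fin (E.ansLen lam) → Bool) → Qubits w)
    (hΦ : ∀ χ, ∑ α, ‖Φ χ α‖ ^ 2 = 1)
    (hM : ∀ y b χ α, (inner ℂ (M.state χ α) (M.N y b (M.state χ α))).re =
      ‖projZero b (runCircuit (if y then C₁ else C₀) (Φ χ α))‖ ^ 2) :
    compiledValue E (tiltedCoeff θ φ τ q) lam M ≤ 2 * (1 + τ ^ 2) +
      1 / Real.cos φ ^ 2 * |average E lam false (fun _ χ α => parityProb hG C₀ C₁ (Φ χ α)) -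
        average E lam true (fun _ χ α => parityProb hG C₀ C₁ (Φ χ α))| +
      2 * τ ^ 2 * |Real.cos (2 * θ) / Real.cos φ| *
        (|average E lam false (fun _ χ α => ‖projZero true (runCircuit C₀ (Φ χ α))‖ ^ 2) -
          average E lam true (fun _ χ α => ‖projZero true (runCircuit C₀ (Φ χ α))‖ ^ 2)| +
        |average E lam false (fun _ χ α => ‖projZero true (runCircuit C₁ (Φ χ α))‖ ^ 2) -
          average E lam true (fun _ χ α => ‖projZero true (runCircuit C₁ (Φ χ α))‖ ^ 2)|) := by
  set A := average E lam with hA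
  set S := Real.sin φ
  set C := Real.cos φ with hCdef
  set s := Real.sin (2 * θ)
  set c := Real.cos (2 * θ)
  have hT : ∀ x, A x (fun _ χ α => ‖Φ χ α‖ ^ 2) = 1 := fun x => average_eq_one hΦ
  have hm : ∀ (D : List (G × ℕ × ℕ)) x, A x (fun _ χ α => bias D (Φ χ α)) =
      1 - 2 * A x (fun _ χ α => ‖projZero true (runCircuit D (Φ χ α))‖ ^ 2) := by
    intro D x
    have h1 := average_add (E := E) (lam := lam) (x := x) (F := fun _ χ α => ‖Φ χ α‖ ^ 2)
      (F' := fun _ χ α => (-2) * ‖projZero true (runCircuit D (Φ χ α))‖ ^ 2)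
    rw [average_const_mul, ← hA, hT] at h1
    rw [sub_eq_add_neg, ← neg_mul, ← h1]
    congr 1
    funext _ χ α
    rw [bias_eq hG]
    ring
  set g : (Fin (E.ctLen lam) → Bool) → (Fin (E.ansLen lam) → Bool) → ℝ :=
    fun χ α => ‖Φ χ α‖ ^ 2 - 2 * parityProb hG C₀ C₁ (Φ χ α) with hg
  have hgA : ∀ x, A x (fun _ => g) =
      1 - 2 * A x (fun _ χ α => parityProb hG C₀ C₁ (Φ χ α)) := by
    intro x
    have h1 := average_add (E := E) (lam := lam) (x := x) (F := fun _ χ α => ‖Φ χ α‖ ^ 2)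
      (F' := fun _ χ α => (-2) * parityProb hG C₀ C₁ (Φ χ α))
    rw [average_const_mul, ← hA, hT] at h1
    rw [sub_eq_add_neg, ← neg_mul, ← h1]
    congr 1
    funext _ χ α
    rw [hg]
    ring
  have hval : compiledValue E (tiltedCoeff θ φ τ q) lam M =
      1 / C * (A false (fun a χ α => boolSign a * bias C₀ (Φ χ α)) +
        A false (fun a χ α => boolSign a * bias C₁ (Φ χ α))) +
      τ ^ 2 * (s / S) * (A true (fun a χ α => boolSign a * bias C₀ (Φ χ α)) -
        A true (fun a χ α => boolSign a * bias C₁ (Φ χ α))) +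
      τ ^ 2 * (c / C) * ((q false).toReal * (A false (fun _ χ α => bias C₀ (Φ χ α)) +
          A false (fun _ χ α => bias C₁ (Φ χ α))) +
        (q true).toReal * (A true (fun _ χ α => bias C₀ (Φ χ α)) +
          A true (fun _ χ α => bias C₁ (Φ χ α)))) := by
    have hp : ∀ x y, A x (fun a χ α => boolSign a * bias (if y then C₁ else C₀) (Φ χ α)) =
        compiledProb E lam M false false x y - compiledProb E lam M true false x y -
        (compiledProb E lam M false true x y - compiledProb E lam M true true x y) := by
      intro x y
      simp only [compiledProb_eq_average, hM, hA, average, ← Finset.sum_sub_distrib]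
      refine Finset.sum_congr rfl fun ω _ => ?_
      cases ω.2.2.2 <;> simp [boolSign, bias] <;> ring
    have hp' : ∀ x y, A x (fun _ χ α => bias (if y then C₁ else C₀) (Φ χ α)) =
        compiledProb E lam M false false x y + compiledProb E lam M true false x y -
        (compiledProb E lam M false true x y + compiledProb E lam M true true x y) := by
      intro x y
      simp only [compiledProb_eq_average, hM, hA, average, ← Finset.sum_add_distrib,
        ← Finset.sum_sub_distrib]
      refine Finset.sum_congr rfl fun ω _ => ?_
      cases ω.2.2.2 <;> simp [bias] <;> ring
    have e1 := hp false false
    have e2 := hp false true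
    have e3 := hp true false
    have e4 := hp true true
    have e5 := hp' false false
    have e6 := hp' false true
    have e7 := hp' true false
    have e8 := hp' true true
    simp only [if_true, Bool.false_eq_true, if_false] at e1 e2 e3 e4 e5 e6 e7 e8
    rw [e1, e2, e3, e4, e5, e6, e7, e8]
    simp only [compiledValue, tiltedCoeff, Fintype.sum_bool, boolSign, if_true, if_false,
      Bool.true_eq_false, Bool.false_eq_true]
    ring
  -- Linearity carries the pointwise quadratic forms to averages. The sign of the decrypted answer
  -- stays inside, since the coefficients of the vectors depend on it.
  have hlin : ∀ x (r₁ r₂ r₃ r₄ r₅ r₆ : ℝ), A x (fun a χ α => r₁ * ‖Φ χ α‖ ^ 2 +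
      r₂ * (boolSign a * bias C₀ (Φ χ α)) + r₃ * (boolSign a * bias C₁ (Φ χ α)) +
      r₄ * bias C₀ (Φ χ α) + r₅ * bias C₁ (Φ χ α) + r₆ * g χ α) =
      r₁ + r₂ * A x (fun a χ α => boolSign a * bias C₀ (Φ χ α)) +
        r₃ * A x (fun a χ α => boolSign a * bias C₁ (Φ χ α)) +
        r₄ * A x (fun _ χ α => bias C₀ (Φ χ α)) + r₅ * A x (fun _ χ α => bias C₁ (Φ χ α)) +
        r₆ * A x (fun _ => g) := by
    intro x r₁ r₂ r₃ r₄ r₅ r₆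
    simp only [hA, average_add, average_const_mul]
    rw [← hA, hT, mul_one]
  have h₀ : 0 ≤ 1 + 1 / (2 * C ^ 2) -
      1 / C * (A false (fun a χ α => boolSign a * bias C₀ (Φ χ α)) +
        A false (fun a χ α => boolSign a * bias C₁ (Φ χ α))) +
      1 / (2 * C ^ 2) * A false (fun _ => g) := by
    have h := hlin false (1 + 1 / (2 * C ^ 2)) (-(1 / C)) (-(1 / C)) 0 0 (1 / (2 * C ^ 2))
    have h' := average_nonneg (E := E) (lam := lam) (x := false)
      (F := fun a χ α => (1 + 1 / (2 * C ^ 2)) * ‖Φ χ α‖ ^ 2 +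
      (-(1 / C)) * (boolSign a * bias C₀ (Φ χ α)) + (-(1 / C)) * (boolSign a * bias C₁ (Φ χ α)) +
      0 * bias C₀ (Φ χ α) + 0 * bias C₁ (Φ χ α) + 1 / (2 * C ^ 2) * g χ α) (fun a χ α => by
        -- The square of `ψ ∓ (B₀ + B₁)ψ/(2C)`.
        have hq := bias_quadratic_form_nonneg hG C₀ C₁ (Φ χ α) 1 (-(boolSign a / (2 * C)))
          (-(boolSign a / (2 * C)))
        refine hq.trans_eq ?_
        have hs : (boolSign a / (2 * C)) * (boolSign a / (2 * C)) = 1 / (4 * C ^ 2) := by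
          rw [div_mul_div_comm, mul_self_boolSign]; congr 1; ring
        have e1 : (1 : ℝ) / (2 * C ^ 2) = 2 * (1 / (4 * C ^ 2)) := by field_simp; norm_num
        have e2 : boolSign a / (2 * C) = boolSign a * (1 / C) / 2 := by field_simp
        rw [e1, ← hs, e2, hg]
        ring)
    rw [← hA, h] at h'
    linarith
  have h₁ : 0 ≤ 1 + (s ^ 2 / (2 * S ^ 2) + c ^ 2 / (2 * C ^ 2)) -
      s / S * (A true (fun a χ α => boolSign a * bias C₀ (Φ χ α)) -
        A true (fun a χ α => boolSign a * bias C₁ (Φ χ α))) -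
      c / C * (A true (fun _ χ α => bias C₀ (Φ χ α)) + A true (fun _ χ α => bias C₁ (Φ χ α))) +
      (c ^ 2 / (2 * C ^ 2) - s ^ 2 / (2 * S ^ 2)) * A true (fun _ => g) := by
    have h := hlin true (1 + (s ^ 2 / (2 * S ^ 2) + c ^ 2 / (2 * C ^ 2))) (-(s / S)) (s / S)
      (-(c / C)) (-(c / C)) (c ^ 2 / (2 * C ^ 2) - s ^ 2 / (2 * S ^ 2))
    have h' := average_nonneg (E := E) (lam := lam) (x := true)
      (F := fun a χ α => (1 + (s ^ 2 / (2 * S ^ 2) + c ^ 2 / (2 * C ^ 2))) * ‖Φ χ α‖ ^ 2 +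
      (-(s / S)) * (boolSign a * bias C₀ (Φ χ α)) + (s / S) * (boolSign a * bias C₁ (Φ χ α)) +
      (-(c / C)) * bias C₀ (Φ χ α) + (-(c / C)) * bias C₁ (Φ χ α) +
      (c ^ 2 / (2 * C ^ 2) - s ^ 2 / (2 * S ^ 2)) * g χ α) (fun a χ α => by
        -- The square of `-ψ ± s(B₀ - B₁)ψ/(2S) + c(B₀ + B₁)ψ/(2C)`; the marginal term carries no
        -- sign of the answer.
        have hq := bias_quadratic_form_nonneg hG C₀ C₁ (Φ χ α) (-1)
          (boolSign a * (s / S) / 2 + c / C / 2) (-(boolSign a * (s / S) / 2) + c / C / 2)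
        refine hq.trans_eq ?_
        have e1 : s ^ 2 / (2 * S ^ 2) = (boolSign a * boolSign a) * ((s / S) ^ 2 / 2) := by
          rw [mul_self_boolSign]; field_simp
        have e2 : c ^ 2 / (2 * C ^ 2) = (c / C) ^ 2 / 2 := by field_simp
        rw [e1, e2, hg]
        ring)
    rw [← hA, h] at h'
    linarith
  have hq1 : (q false).toReal + (q true).toReal = 1 := by
    have := PMF.sum_toReal q
    rw [Fintype.sum_bool] at this
    linarith
  have hmain := tilted_sum_of_squares (m₀ := A false (fun _ χ α => bias C₀ (Φ χ α)) +
    A false (fun _ χ α => bias C₁ (Φ χ α))) hS hC (Real.sin_sq_add_cos_sq φ)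
    (Real.sin_sq_add_cos_sq (2 * θ)) hτ0
    (by rw [hτ, Real.tan_eq_sin_div_cos]) hq1 h₀ h₁
  rw [hval]
  refine hmain.trans ?_
  rw [hgA, hgA, hm, hm, hm, hm]
  set p₀ := A false (fun _ χ α => parityProb hG C₀ C₁ (Φ χ α))
  set p₁ := A true (fun _ χ α => parityProb hG C₀ C₁ (Φ χ α))
  set u₀ := A false (fun _ χ α => ‖projZero true (runCircuit C₀ (Φ χ α))‖ ^ 2)
  set u₁ := A true (fun _ χ α => ‖projZero true (runCircuit C₀ (Φ χ α))‖ ^ 2)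
  set v₀ := A false (fun _ χ α => ‖projZero true (runCircuit C₁ (Φ χ α))‖ ^ 2)
  set v₁ := A true (fun _ χ α => ‖projZero true (runCircuit C₁ (Φ χ α))‖ ^ 2)
  have hq0 : (q false).toReal ≤ 1 := by
    linarith [ENNReal.toReal_nonneg (a := q true)]
  have hC2 : 0 < C ^ 2 := by positivity
  have t1 : 1 / (2 * C ^ 2) * (1 - 2 * p₀ - (1 - 2 * p₁)) ≤ 1 / C ^ 2 * |p₀ - p₁| := by
    have : 1 / (2 * C ^ 2) * (1 - 2 * p₀ - (1 - 2 * p₁)) = 1 / C ^ 2 * (-(p₀ - p₁)) := by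
      field_simp; ring
    rw [this]
    exact mul_le_mul_of_nonneg_left (neg_le_abs _) (by positivity)
  have t2 : c / C * ((q false).toReal * (1 - 2 * u₀ + (1 - 2 * v₀) - (1 - 2 * u₁ + (1 - 2 * v₁))))
      ≤ 2 * |c / C| * (|u₀ - u₁| + |v₀ - v₁|) := by
    have e : c / C * ((q false).toReal * (1 - 2 * u₀ + (1 - 2 * v₀) - (1 - 2 * u₁ + (1 - 2 * v₁))))
      = 2 * (q false).toReal * (c / C * -((u₀ - u₁) + (v₀ - v₁))) := by ring
    rw [e]
    have b1 : c / C * -((u₀ - u₁) + (v₀ - v₁)) ≤ |c / C| * (|u₀ - u₁| + |v₀ - v₁|) := by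
      refine (le_abs_self _).trans ?_
      rw [abs_mul, abs_neg]
      exact mul_le_mul_of_nonneg_left (abs_add_le _ _) (abs_nonneg _)
    have b2 : 0 ≤ |c / C| * (|u₀ - u₁| + |v₀ - v₁|) := by positivity
    have b3 : 0 ≤ (q false).toReal := ENNReal.toReal_nonneg
    nlinarith [mul_le_mul_of_nonneg_left b1 b3, mul_nonneg b2 (sub_nonneg.2 hq0)]
  have t3 := mul_le_mul_of_nonneg_left t2 (sq_nonneg τ)
  linarith

/-- Since `1 / 0 = 0`, the relation has to exclude `τ = 0` itself: its right side would vanish,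
forcing `sin² 2θ = sin² φ`, whereas `0 < |φ| < 2θ ≤ π/2` gives a strict inequality. -/
theorem tilted_parameters {θ φ τ : ℝ} (hθ : θ ∈ Set.Ioc 0 (Real.pi / 4))
    (hφ : φ ∈ Set.Ioo (max (-2 * θ) (-Real.pi + 2 * θ)) (min (2 * θ) (Real.pi - 2 * θ)))
    (hφ0 : φ ≠ 0)
    (hτ : 1 / τ ^ 2 = Real.sin (2 * θ) ^ 2 / Real.tan φ ^ 2 - Real.cos (2 * θ) ^ 2) :
    Real.sin φ ≠ 0 ∧ Real.cos φ ≠ 0 ∧ τ ≠ 0 := by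
  have hpi := Real.pi_pos
  obtain ⟨h1, h2⟩ := hφ
  have h1a := (le_max_left _ _).trans_lt h1
  have h2a := h2.trans_le (min_le_left _ _)
  obtain ⟨ht0, ht1⟩ := hθ
  have habs : |φ| < 2 * θ := abs_lt.2 ⟨by linarith, h2a⟩
  have hpos : 0 < |φ| := abs_pos.2 hφ0
  have hC : 0 < Real.cos φ := Real.cos_pos_of_mem_Ioo ⟨by linarith, by linarith⟩
  have hSabs : 0 < Real.sin |φ| := Real.sin_pos_of_pos_of_lt_pi hpos (by linarith)
  have hsq : Real.sin |φ| ^ 2 = Real.sin φ ^ 2 := by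
    rcases abs_choice φ with h | h <;> rw [h]
    rw [Real.sin_neg, neg_sq]
  have hS : Real.sin φ ≠ 0 := by
    intro h
    rw [h] at hsq
    have : 0 < Real.sin |φ| ^ 2 := by positivity
    rw [hsq] at this
    norm_num at this
  have hlt : Real.sin |φ| < Real.sin (2 * θ) :=
    Real.sin_lt_sin_of_lt_of_le_pi_div_two (by linarith) (by linarith) habs
  refine ⟨hS, hC.ne', ?_⟩
  rintro rfl
  rw [Real.tan_eq_sin_div_cos, zero_pow two_ne_zero, div_zero] at hτ
  have hS2 : 0 < Real.sin φ ^ 2 := by positivity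
  have h3 : Real.sin (2 * θ) ^ 2 * Real.cos φ ^ 2 = Real.cos (2 * θ) ^ 2 * Real.sin φ ^ 2 := by
    field_simp at hτ
    linarith
  have h4 := Real.sin_sq_add_cos_sq φ
  have h5 := Real.sin_sq_add_cos_sq (2 * θ)
  have h6 : Real.sin (2 * θ) ^ 2 = Real.sin φ ^ 2 := by
    rw [← eq_sub_iff_add_eq'] at h4 h5
    rw [h4, h5] at h3
    linarith
  rw [← hsq] at h6
  nlinarith

end
theorem mainTheorem2 (θ φ τ : ℝ)
    (hθ : θ ∈ Set.Ioc 0 (Real.pi / 4))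
    (hφ : φ ∈ Set.Ioo (max (-2 * θ) (-Real.pi + 2 * θ)) (min (2 * θ) (Real.pi - 2 * θ)))
    (hφ0 : φ ≠ 0)
    (hτ : 1 / τ ^ 2 = Real.sin (2 * θ) ^ 2 / Real.tan φ ^ 2 - Real.cos (2 * θ) ^ 2)
    (q : PMF Bool)
    (G : Set GateMatrix) (hG : IsGateSet G)
    (E : EncryptionScheme) (hE : E.IsSecure G)
    (M : (lam : ℕ) → CompiledModel (E.ctLen lam) (E.ansLen lam)) (hM : IsQPT G E M) :
    ∃ negl : ℕ → ℝ, Negligible negl ∧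
      ∀ lam : ℕ, compiledValue E (tiltedCoeff θ φ τ q) lam (M lam) ≤ 2 * (1 + τ ^ 2) + negl lam := by
  obtain ⟨hS, hC, hτ0⟩ := tilted_parameters hθ hφ hφ0 hτ
  obtain ⟨hlen, ⟨CS, hCS, hstate⟩, hN⟩ := hM
  obtain ⟨m₀, C₀, hC₀, hN₀⟩ := hN false
  obtain ⟨m₁, C₁, hC₁, hN₁⟩ := hN true
  -- A common wire count for all circuits. A sum is easy to compute by register programs, and the
  -- extra 1 ensures that wire `0` exists. Two further wires hold the recorded outcome and discarded
  -- oracle replies.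
  set w : ℕ → ℕ := fun lam => ((M lam).n + m₀ lam) + ((M lam).n + m₁ lam) + 1 with hw
  have wires : ∀ {n lam : ℕ} {C : List (G × ℕ × ℕ)}, n ≤ w lam →
      (∀ op ∈ C, op.2.1 < n ∧ op.2.2 < n ∧ op.2.1 ≠ op.2.2) →
      ∀ op ∈ C, op.2.1 < w lam ∧ op.2.2 < w lam ∧ op.2.1 ≠ op.2.2 := fun hn hC op hop =>
    ⟨(hC op hop).1.trans_le hn, (hC op hop).2.1.trans_le hn, (hC op hop).2.2⟩
  have wires' : ∀ {lam : ℕ} {C : List (G × ℕ × ℕ)},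
      (∀ op ∈ C, op.2.1 < w lam ∧ op.2.2 < w lam ∧ op.2.1 ≠ op.2.2) →
      ∀ op ∈ C, op.2.1 < w lam + 2 ∧ op.2.2 < w lam + 2 ∧ op.2.1 ≠ op.2.2 := fun hC op hop =>
    ⟨(hC op hop).1.trans_le (by omega), (hC op hop).2.1.trans_le (by omega), (hC op hop).2.2⟩
  have hnw : ∀ lam, (M lam).n ≤ w lam := fun lam => by simp only [hw]; omega
  have h0w : ∀ lam, (M lam).n + m₀ lam ≤ w lam := fun lam => by simp only [hw]; omega
  have h1w : ∀ lam, (M lam).n + m₁ lam ≤ w lam := fun lam => by simp only [hw]; omega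
  have hwS := fun lam => wires (hnw lam) (hCS.1 lam)
  have hw₀ := fun lam => wires (h0w lam) (hC₀.1 lam)
  have hw₁ := fun lam => wires (h1w lam) (hC₁.1 lam)
  have hw0 : ∀ lam, 0 < w lam := fun lam => Nat.succ_pos _
  -- The reduction: any uniform continuation `D` of the first round whose acceptance probability
  -- ignores the discarded replies has averages nearly independent of the question.
  have secure : ∀ D : ℕ → List (G × ℕ × ℕ),
      Emits w (fun lam => (D lam).map (mapOp (some : G → Option G))) →
      (∀ lam, ∀ op ∈ D lam, op.2.1 < w lam + 2 ∧ op.2.2 < w lam + 2 ∧ op.2.1 ≠ op.2.2) →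
      ∀ F : (lam : ℕ) → Qubits (w lam) → ℝ, (∀ lam, ∀ d : ℕ → Bool, d (w lam) = false → ∀ ψ,
        ‖projZero true (runCircuit (D lam) (embedPat (w lam + 2) d ψ))‖ ^ 2 = F lam ψ) →
      Negligible fun lam =>
        |average E lam false (fun _ χ α =>
          F lam (embedPat (w lam) (fun _ => false) ((M lam).state χ α))) -
        average E lam true (fun _ χ α =>
          F lam (embedPat (w lam) (fun _ => false) ((M lam).state χ α)))| := by
    intro D hD hDw F hF
    have h := hE (fun lam => w lam + 2)
      (fun lam => secondRoundAdversary (CS lam) (E.ansLen lam) (w lam) (D lam))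
      (Emits.logspaceUniform hC₀ hC₁ some (Emits.secondRoundAdversary hCS hD) fun lam =>
        secondRoundAdversary_wires ((hlen lam).2.trans (hnw lam)) (hwS lam) (hDw lam)) false true
    simp only [fun lam => adversaryProb_eq_average (hlen lam).1 (hlen lam).2 (hnw lam)
      (hCS.1 lam) (hF lam), ← hstate] at h
    exact h
  have s₀ := secure C₀ (hC₀.emits w some) (fun lam => wires' (hw₀ lam))
    (fun lam ψ => ‖projZero true (runCircuit (C₀ lam) ψ)‖ ^ 2) (fun lam d _ ψ => by
      rw [runCircuit_embedPat (by omega) d (hw₀ lam), projZero_embedPat (hw0 lam) (by omega),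
        norm_embedPat (by omega)])
  have s₁ := secure C₁ (hC₁.emits w some) (fun lam => wires' (hw₁ lam))
    (fun lam ψ => ‖projZero true (runCircuit (C₁ lam) ψ)‖ ^ 2) (fun lam d _ ψ => by
      rw [runCircuit_embedPat (by omega) d (hw₁ lam), projZero_embedPat (hw0 lam) (by omega),
        norm_embedPat (by omega)])
  have sp := secure (fun lam => parityCircuit hG (C₀ lam) (C₁ lam) (w lam))
    (Emits.parityCircuit hG hC₀ hC₁)
    (fun lam => parityCircuit_wires hG (hw0 lam) (hw₀ lam) (hw₁ lam))
    (fun lam ψ => parityProb hG (C₀ lam) (C₁ lam) ψ) (fun lam d hd ψ =>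
      projZero_parityCircuit hG (hw0 lam) (hw₀ lam) (hw₁ lam) hd ψ)
  refine ⟨_, (sp.const_mul (r := 1 / Real.cos φ ^ 2) (by positivity)).add
    ((s₀.add s₁).const_mul (r := 2 * τ ^ 2 * |Real.cos (2 * θ) / Real.cos φ|) (by positivity)),
    fun lam => ?_⟩
  rw [← add_assoc]
  refine compiledValue_tilted_le hG q hS hC hτ0 hτ (M lam) (C₀ lam) (C₁ lam)
    (fun χ α => embedPat (w lam) (fun _ => false) ((M lam).state χ α)) (fun χ => ?_)
    (fun y b χ α => ?_)
  · simp only [norm_embedPat (hnw lam), hstate]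
    rw [sum_norm_sq_proj, norm_runCircuit hG, norm_inputKet, one_pow]
  · cases y
    · rw [hN₀, Complex.ofReal_re, padZeros_eq_embedPat]
      change ‖projZero b _‖ ^ 2 = _
      -- Each measurement comes with its own number of ancillas; idle zero wires bring it to the
      -- common `w lam` without changing probabilities.
      rw [← norm_embedPat (h0w lam) (fun _ => false), ← projZero_embedPat_false (h0w lam),
        ← runCircuit_embedPat (h0w lam) _ (hC₀.1 lam), embedPat_embedPat (by omega) (h0w lam)]
      rfl
    · rw [hN₁, Complex.ofReal_re, padZeros_eq_embedPat]
      change ‖projZero b _‖ ^ 2 = _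
      rw [← norm_embedPat (h1w lam) (fun _ => false), ← projZero_embedPat_false (h1w lam),
        ← runCircuit_embedPat (h1w lam) _ (hC₁.1 lam), embedPat_embedPat (by omega) (h1w lam)]
      rfl
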